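/- Let $X$ be a complex Banach space, let $L(X)$ be the algebra of bounded linear operators on $X$, and let $T\in L(X)$. Definitions. An operator $S\in L(Y)$ on a complex Banach space $Y$ is \emph{meromorphic} if $0$ is the only possible accumulation point of its spectrum $\sigma(S)$ and every nonzero isolated point of $\sigma(S)$ is a pole of the resolvent of $S$; it is \emph{polynomially meromorphic} if $P(S)$ is meromorphic for some nonconstant complex polynomial $P$; it is \emph{quasinilpotent} if its spectral radius is $0$; and it is \emph{B-Fredholm} if for some integer $m\ge 0$ the range $R(S^m)$ is closed and the restriction of $S$ to an operator $R(S^m)\to R(S^m)$ is Fredholm. Put $\sigma_{BF}(S)=\{\lambda\in\mathbb C : S-\lambda I \text{ is not B-Fredholm}\}$. The operator $T$ has a \emph{generalized meromorphic resolvent} if $(T-\lambda I)^{-1}$ is polynomially meromorphic for some $\lambda$ in the resolvent set of $T$. Write $[A,B]=AB-BA$. Theorem. Suppose that $T$ has a generalized meromorphic resolvent. Then: 1. $T$ is polynomially meromorphic. 2. There are an integer $n\ge 1$, closed $T$-invariant subspaces $X_1,\dots,X_n$ with $X=X_1\oplus\dots\oplus X_n$, scalars $\lambda_i\in\mathbb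 C$ and operators $M_i,Q_i\in L(X_i)$ such that $$T=\bigoplus_{i=1}^n (M_i+Q_i+\lambda_i I_i),$$ where $I_i$ is the identity operator of $X_i$, each $M_i$ is meromorphic, and each $Q_i$ and each commutator $[M_i,Q_i]$ is quasinilpotent. 3. The data in 2 can be chosen so that the operators $M=\bigoplus_i M_i$, $Q=\bigoplus_i Q_i$ and $U=\bigoplus_i\lambda_i I_i$ in $L(X)$ satisfy: $T=M+Q+U$, $M$ is meromorphic, $Q$ and $[M,Q]$ are quasinilpotent, and the diagonal operator $U$ satisfies $\sigma(U)=\sigma_{BF}(T)$ whenever $\sigma_{BF}(T)\neq\emptyset$. -/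

import Mathlib

open Polynomial Topology Filter

section BoundedOperators

variable {Y : Type*} [NormedAddCommGroup Y] [NormedSpace ℂ Y]

/-- `z` is a pole of the resolvent `μ ↦ (μ - T)⁻¹` of `T`: the resolvent is meromorphic at `z`,
of negative order. -/
def IsResolventPole (T : Y →L[ℂ] Y) (z : ℂ) : Prop :=
  MeromorphicAt (fun μ : ℂ => resolvent T μ) z ∧
    meromorphicOrderAt (fun μ : ℂ => resolvent T μ) z < 0

/-- `T` is a meromorphic operator: `0` is the only possible accumulation point of the spectrum
of `T`, and every nonzero isolated point of the spectrum is a pole of the resolvent of `T`. -/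
def IsMeromorphicOperator (T : Y →L[ℂ] Y) : Prop :=
  (∀ z : ℂ, AccPt z (𝓟 (spectrum ℂ T)) → z = 0) ∧
    ∀ z ∈ spectrum ℂ T, z ≠ 0 → ¬ AccPt z (𝓟 (spectrum ℂ T)) → IsResolventPole T z

/-- `T` is polynomially meromorphic: `P(T)` is meromorphic for some nonconstant polynomial `P`. -/
def IsPolynomiallyMeromorphic (T : Y →L[ℂ] Y) : Prop :=
  ∃ P : ℂ[X], 0 < P.natDegree ∧ IsMeromorphicOperator (aeval T P)

/-- `T` has a generalized meromorphic resolvent: `(T - z)⁻¹` is polynomially meromorphic for some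
`z` in the resolvent set of `T`. -/
def HasGeneralizedMeromorphicResolvent (T : Y →L[ℂ] Y) : Prop :=
  ∃ z ∈ resolventSet ℂ T,
    IsPolynomiallyMeromorphic (Ring.inverse (T - algebraMap ℂ (Y →L[ℂ] Y) z))

/-- `T` is quasinilpotent: its spectral radius is zero. -/
def IsQuasinilpotentOperator (T : Y →L[ℂ] Y) : Prop :=
  spectralRadius ℂ T = 0

theorem mapsTo_range_pow (T : Y →L[ℂ] Y) (n : ℕ) :
    ∀ x ∈ (T ^ n).range, T x ∈ (T ^ n).range := by
  rintro _ ⟨y, rfl⟩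
  refine ⟨T y, ?_⟩
  have h : T ^ n * T = T * T ^ n := by rw [← pow_succ, ← pow_succ']
  exact DFunLike.congr_fun h y

/-- The restriction of `T` to the range of `T ^ n`, as an operator from this range to itself. -/
def restrictRangePow (T : Y →L[ℂ] Y) (n : ℕ) : (T ^ n).range →L[ℂ] (T ^ n).range :=
  T.restrict (mapsTo_range_pow T n)

/-- `T` is a B-Fredholm operator: for some `n ≥ 0` the range of `T ^ n` is closed and the
restriction of `T` to it is a Fredholm operator. -/
def IsBFredholm (T : Y →L[ℂ] Y) : Prop :=
  ∃ n : ℕ, IsClosed ((T ^ n).range : Set Y) ∧ (restrictRangePow T n).IsFredholm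

/-- The B-Fredholm spectrum of `T`. -/
def bFredholmSpectrum (T : Y →L[ℂ] Y) : Set ℂ :=
  {z : ℂ | ¬ IsBFredholm (T - algebraMap ℂ (Y →L[ℂ] Y) z)}

/-- For a direct sum decomposition of `Y` into subspaces `V i`, this says that `T` is the direct
sum of the operators `A i` on `V i`; in particular each `V i` is `T`-invariant. -/
def IsDirectSumOfOperators {ι : Type*} (V : ι → Submodule ℂ Y) (A : ∀ i, V i →L[ℂ] V i)
    (T : Y →L[ℂ] Y) : Prop :=
  ∀ (i : ι) (x : V i), T (x : Y) = (A i x : Y)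

end BoundedOperators

/-! Everything is translated into Drazin invertibility. An operator S is meromorphic iff S - z is
Drazin invertible for every z ≠ 0 (`isMeromorphicOperator_iff`). Drazin invertibility passes between
P(T) and the factors T - t over the roots t of P, so T is polynomially meromorphic iff the set D of
all z with T - z not Drazin invertible is finite (`isPolynomiallyMeromorphic_iff`). The map t ↦ (t -
z)⁻¹ carries D into the corresponding set of (T - z)⁻¹, which gives the first claim.

When D is finite, the Riesz projections of small circles around its points, together with the
complementary projection, split X (`exists_spectral_decomposition`). On the summand of d ∈ D, T - z
is Drazin invertible for all z ≠ d, so T - d is meromorphic there. On the remaining summand T - z is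
Drazin invertible for every z, so any scalar will do; a point of D is used if there is one. Hence M
= T - U is meromorphic and Q = 0 suffices.

The spectrum of U consists of the scalars with nonzero projection, which is D if D is nonempty.
Finally D is the B-Fredholm spectrum (`bFredholmSpectrum_eq_drazinSpectrum`): Drazin invertible
operators are B-Fredholm, and a B-Fredholm S for which S - z is invertible for arbitrarily small z ≠
0 is Drazin invertible. -/

/-! ### Drazin invertible elements of a ring. -/

section DrazinInvertible

/-- An element `a` of a ring is Drazin invertible if `a ^ m = a ^ (m + 1) * b` for some `m` and
some `b` in the double commutant of `a`. -/
def IsDrazinInvertible {R : Type*} [Ring R] (a : R) : Prop :=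
  ∃ (m : ℕ) (b : R), (∀ c, Commute a c → Commute b c) ∧ a ^ m = a ^ (m + 1) * b

variable {R : Type*} [Ring R] {a b c : R}

theorem pow_eq_pow_add_mul_pow {m : ℕ} (hm : a ^ m = a ^ (m + 1) * b) (j : ℕ) :
    a ^ m = a ^ (m + j) * b ^ j := by
  induction j with
  | zero => simp
  | succ j ih =>
    calc a ^ m = a ^ j * a ^ m * b ^ j := by rw [← pow_add, add_comm j, ← ih]
      _ = a ^ j * (a ^ (m + 1) * b) * b ^ j := by rw [← hm]
      _ = a ^ (m + (j + 1)) * b ^ (j + 1) := by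
        rw [← mul_assoc, ← pow_add, mul_assoc, ← pow_succ']; congr 2; omega

theorem pow_eq_pow_succ_mul_of_le {m n : ℕ} (hm : a ^ m = a ^ (m + 1) * b) (hn : m ≤ n) :
    a ^ n = a ^ (n + 1) * b := by
  obtain ⟨k, rfl⟩ := Nat.exists_eq_add_of_le' hn
  rw [pow_add, hm, ← mul_assoc, ← pow_add]; rfl

/-- It suffices to find `b` commuting with `a`. -/
theorem IsDrazinInvertible.of_commute (h : Commute a b) {m : ℕ} (hm : a ^ m = a ^ (m + 1) * b) :
    IsDrazinInvertible a := by
  have key := pow_eq_pow_add_mul_pow hm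
  have hab (i j : ℕ) : b ^ i * a ^ j = a ^ j * b ^ i := ((h.pow_pow j i).eq).symm
  -- e is an idempotent fixing a^m from both sides. If c commutes with a, then e c (1 - e) and (1 -
  -- e) c e vanish, so e is in the double commutant of a. Then so is b e, the inverse of a in the
  -- corner of e.
  set e := a ^ m * b ^ m with he
  have hae : a ^ m * e = a ^ m := by rw [he, ← mul_assoc, ← pow_add, ← key]
  have hea : e * a ^ m = a ^ m := by rw [he, mul_assoc, hab, ← mul_assoc, ← pow_add, ← key]
  have hee : e * e = e := by
    nth_rw 2 [he]
    rw [← mul_assoc, hea]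
  have hec : ∀ c, Commute a c → e * c = c * e := by
    intro c hc
    have hcm : a ^ m * c = c * a ^ m := (hc.pow_left m).eq
    have h1 : e * c * (1 - e) = 0 := by
      have : e * c * (1 - e) = b ^ m * c * (a ^ m - a ^ m * e) := by
        rw [he, ← hab]
        simp only [mul_sub, mul_one, mul_assoc]
        rw [hcm, ← mul_assoc (a ^ m) c, hcm]
        simp only [mul_assoc]
      rw [this, hae, sub_self, mul_zero]
    have h2 : (1 - e) * c * e = 0 := by
      have : (1 - e) * c * e = (a ^ m - e * a ^ m) * c * b ^ m := by
        rw [he]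
        simp only [sub_mul, one_mul, mul_assoc]
        rw [← mul_assoc c, ← hcm]
        simp only [mul_assoc]
      rw [this, hea, sub_self, zero_mul, zero_mul]
    have h3 : e * c = e * c * e := by simpa [mul_sub, sub_eq_zero] using h1
    have h4 : c * e = e * c * e := by simpa [sub_mul, sub_eq_zero] using h2
    rw [h3, h4]
  have hbe : b * e = e * b := (hec b h).symm
  have habe : a * (b * e) = e := by
    have h1 : a * (b * a ^ m) = a ^ m := by
      rw [← pow_one b, hab, ← mul_assoc, ← pow_succ', ← key 1]
    rw [he, ← mul_assoc b, ← mul_assoc a, h1]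
  clear_value e
  have hae' : e * a = a * e := hec a (Commute.refl a)
  have hbea : b * e * a = e := by
    rw [mul_assoc, hae', ← mul_assoc, ← h.eq, mul_assoc, habe]
  refine ⟨m, b * e, fun c hc => ?_, ?_⟩
  · have hcc := hec c hc
    have e1 : b * e * e = b * e := by rw [mul_assoc, hee]
    have e2 : e * (b * e) = b * e := by rw [← mul_assoc, ← hbe, mul_assoc, hee]
    show b * e * c = c * (b * e)
    calc b * e * c = b * e * c * e := by
          rw [mul_assoc (b * e), ← hcc, ← mul_assoc, e1]
      _ = b * e * (c * (a * (b * e))) := by rw [habe, ← mul_assoc]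
      _ = b * e * a * c * (b * e) := by rw [← mul_assoc c, ← hc.eq]; simp only [mul_assoc]
      _ = c * (b * e) := by rw [hbea, hcc, mul_assoc, e2]
  · rw [← mul_assoc, ← hm, hae]

theorem IsUnit.isDrazinInvertible (h : IsUnit a) : IsDrazinInvertible a := by
  obtain ⟨u, rfl⟩ := h
  exact .of_commute (b := (↑u⁻¹ : R)) (m := 0) (by simp [Commute, SemiconjBy]) (by simp)

/-- The double commutant pays off here: b commutes with c and d with a, so b d serves for a c. -/
theorem IsDrazinInvertible.mul (ha : IsDrazinInvertible a) (hc : IsDrazinInvertible c)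
    (h : Commute a c) : IsDrazinInvertible (a * c) := by
  obtain ⟨m, b, hb, hm⟩ := ha
  obtain ⟨n, d, hd, hn⟩ := hc
  have hm' := pow_eq_pow_succ_mul_of_le hm (le_max_left m n)
  have hn' := pow_eq_pow_succ_mul_of_le hn (le_max_right m n)
  have hba : Commute b a := hb a (.refl a)
  have hbc : Commute b c := hb c h
  have hda : Commute d a := hd a h.symm
  have hdc : Commute d c := hd c (.refl c)
  refine .of_commute (b := b * d) (m := max m n) ?_ ?_
  · exact ((hba.mul_left hda).mul_right (hbc.mul_left hdc)).symm
  · rw [h.mul_pow, h.mul_pow, hm', hn']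
    rw [← pow_eq_pow_succ_mul_of_le hm (le_max_left m n),
      ← pow_eq_pow_succ_mul_of_le hn (le_max_right m n)]
    nth_rw 1 [hm', hn']
    simp only [mul_assoc]
    rw [← mul_assoc b, (hbc.pow_right _).eq, mul_assoc]

theorem IsDrazinInvertible.neg (h : IsDrazinInvertible a) : IsDrazinInvertible (-a) := by
  simpa using h.mul (isUnit_one.neg.isDrazinInvertible) ((Commute.one_right a).neg_right)

theorem isDrazinInvertible_neg_iff : IsDrazinInvertible (-a) ↔ IsDrazinInvertible a :=
  ⟨fun h => by simpa using h.neg, fun h => h.neg⟩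

end DrazinInvertible

/-! ### Drazin invertibility of polynomials in T. -/

section Polynomials

variable {A : Type*} [Ring A] [Algebra ℂ A] (T : A)

theorem aeval_commute_aeval (P Q : ℂ[X]) : Commute (aeval T P) (aeval T Q) := by
  show _ * _ = _ * _
  rw [← map_mul, mul_comm, map_mul]

theorem isDrazinInvertible_aeval {P : ℂ[X]} (hP : P ≠ 0)
    (h : ∀ t, P.IsRoot t → IsDrazinInvertible (T - algebraMap ℂ A t)) :
    IsDrazinInvertible (aeval T P) := by
  have hs : (aeval T) P = algebraMap ℂ A P.leadingCoeff *
      aeval T (P.roots.map fun t => X - C t).prod := by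
    conv_lhs => rw [(IsAlgClosed.splits P).eq_prod_roots]
    simp
  have key : ∀ s : Multiset ℂ, (∀ t ∈ s, IsDrazinInvertible (T - algebraMap ℂ A t)) →
      IsDrazinInvertible (aeval T (s.map fun t => X - C t).prod) := by
    intro s
    induction s using Multiset.induction_on with
    | empty => intro _; simpa using isUnit_one.isDrazinInvertible
    | cons t s ih =>
      intro hs
      rw [Multiset.map_cons, Multiset.prod_cons, map_mul]
      refine IsDrazinInvertible.mul ?_ (ih fun t' ht' => hs t' (Multiset.mem_cons_of_mem ht'))
        (aeval_commute_aeval T _ _)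
      simpa using hs t (Multiset.mem_cons_self t s)
  rw [hs]
  refine IsDrazinInvertible.mul ?_ (key _ fun t ht => h t (isRoot_of_mem_roots ht))
    (Algebra.commutes _ _)
  exact ((isUnit_iff_ne_zero.2 (leadingCoeff_ne_zero.2 hP)).map
    (algebraMap ℂ A)).isDrazinInvertible

/-- A factor of a Drazin invertible element need not be Drazin invertible, so coprimality is used.
Write P = x^k q with x = X - t coprime to q, and multiply the Bézout identity g x^(km+1) + f q^m = 1
by x^(km). The second term becomes f P^m, and P(T)^m = P(T)^(m+1) b contains the factor (T -
t)^(km+1) because k ≥ 1. -/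
theorem isDrazinInvertible_sub_of_isRoot {P : ℂ[X]} (hP : P ≠ 0) {t : ℂ} (ht : P.IsRoot t)
    (h : IsDrazinInvertible (aeval T P)) : IsDrazinInvertible (T - algebraMap ℂ A t) := by
  obtain ⟨q, hq, hnd⟩ := exists_eq_pow_rootMultiplicity_mul_and_not_dvd P hP t
  have hk0 : 0 < P.rootMultiplicity t := (rootMultiplicity_pos hP).2 ht
  generalize P.rootMultiplicity t = k at hq hk0
  obtain ⟨m, b, hb, hm⟩ := h
  have hcop : IsCoprime ((X - C t) ^ (k * m + 1)) (q ^ m) :=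
    (((prime_X_sub_C t).irreducible.coprime_iff_not_dvd).2 hnd).pow
  obtain ⟨g, f, hfg⟩ := hcop
  rw [show T - algebraMap ℂ A t = aeval T (X - C t) by simp]
  set a := aeval T (X - C t) with ha
  have hba : Commute b a := hb a (aeval_commute_aeval T _ _)
  obtain ⟨l, rfl⟩ : ∃ l, k = l + 1 := ⟨k - 1, by omega⟩
  generalize X - C t = x at *
  have hPm : aeval T (P ^ m) = aeval T (x * (x ^ ((l + 1) * m) * x ^ l * q ^ (m + 1))) * b := by
    rw [map_pow, hm, ← map_pow]
    congr 2
    rw [hq, mul_pow]; ring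
  refine IsDrazinInvertible.of_commute (m := (l + 1) * m)
    (b := aeval T (x ^ ((l + 1) * m) * g) + aeval T (x ^ l * q ^ (m + 1) * f) * b) ?_ ?_
  · refine Commute.add_right (aeval_commute_aeval T _ _) ?_
    exact Commute.mul_right (aeval_commute_aeval T _ _) hba.symm
  · calc a ^ ((l + 1) * m)
        = aeval T (x ^ ((l + 1) * m) * (g * x ^ ((l + 1) * m + 1) + f * q ^ m)) := by
          rw [hfg, mul_one, map_pow, ha]
      _ = aeval T (x ^ ((l + 1) * m) * (g * x ^ ((l + 1) * m + 1)))
            + aeval T f * aeval T (P ^ m) := by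
          rw [← map_mul, ← map_add]; congr 1; rw [hq, mul_pow]; ring
      _ = aeval T (x ^ ((l + 1) * m + 1) * (x ^ ((l + 1) * m) * g))
            + aeval T (x ^ ((l + 1) * m + 1) * (x ^ l * q ^ (m + 1) * f)) * b := by
          rw [hPm, ← mul_assoc (aeval T f), ← map_mul]
          congr 1
          · congr 1; ring
          · congr 2; ring
      _ = _ := by rw [map_mul _ (x ^ _), map_mul _ (x ^ ((l + 1) * m + 1)), map_pow, mul_add, mul_assoc, ← ha]

end Polynomials

/-! ### Drazin invertibility and poles of the resolvent. -/

section ResolventPoles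

theorem commute_apply_zero_of_eventually {B : Type*} [NormedRing B] {a : B} {g : ℂ → B} (hg : ContinuousAt g 0)
    (hc : ∀ᶠ w in 𝓝[≠] 0, Commute a (g w)) : Commute a (g 0) :=
  have hg0 : Tendsto g (𝓝[≠] 0) (𝓝 (g 0)) := hg.tendsto.mono_left nhdsWithin_le_nhds
  tendsto_nhds_unique_of_eventuallyEq (tendsto_const_nhds.mul hg0) (hg0.mul tendsto_const_nhds) hc

/-- Let w → 0. The factor 0^n is 1 for n = 0 and 0 otherwise, which serves both cases of the
induction in `pow_eq_of_analyticAt`. -/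
theorem pow_succ_mul_apply_zero {A : Type*} [NormedRing A] [NormedAlgebra ℂ A] {a : A} {n j : ℕ} {g : ℂ → A} (hg : ContinuousAt g 0)
    (he : ∀ᶠ w in 𝓝[≠] 0, (algebraMap ℂ A w - a) * (a ^ j * g w) = w ^ n • a ^ j) :
    a ^ (j + 1) * g 0 = -((0 : ℂ) ^ n • a ^ j) := by
  have hg0 : Tendsto g (𝓝[≠] 0) (𝓝 (g 0)) := hg.tendsto.mono_left nhdsWithin_le_nhds
  have hcont : Tendsto (fun w : ℂ => algebraMap ℂ A w - a) (𝓝[≠] 0) (𝓝 (-a)) := by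
    have : ContinuousAt (fun w : ℂ => algebraMap ℂ A w - a) 0 :=
      ((continuous_algebraMap ℂ A).sub continuous_const).continuousAt
    simpa [ContinuousAt] using this.tendsto.mono_left nhdsWithin_le_nhds
  have he0 : -a * (a ^ j * g 0) = (0 : ℂ) ^ n • a ^ j := by
    refine tendsto_nhds_unique_of_eventuallyEq (hcont.mul (tendsto_const_nhds.mul hg0)) ?_ he
    have : ContinuousAt (fun w : ℂ => w ^ n • a ^ j) 0 := by fun_prop
    exact this.tendsto.mono_left nhdsWithin_le_nhds
  rw [← he0, pow_succ', neg_mul, neg_neg, mul_assoc]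

/-- Comparison of power series coefficients in `(w - a) g(w) = w ^ n`. -/
theorem pow_eq_of_analyticAt {A : Type*} [NormedRing A] [NormedAlgebra ℂ A] (a : A) (n j : ℕ) (g : ℂ → A) (hg : AnalyticAt ℂ g 0)
    (hc : ∀ᶠ w in 𝓝[≠] 0, Commute a (g w))
    (he : ∀ᶠ w in 𝓝[≠] 0, (algebraMap ℂ A w - a) * (a ^ j * g w) = w ^ n • a ^ j) :
    ∃ b, Commute a b ∧ a ^ (n + j) = a ^ (n + j + 1) * b := by
  -- For n = 0, evaluation at w = 0 gives b = -g(0). Otherwise it gives a^(j+1) g(0) = 0, so (g(w) -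
  -- g(0)) / w satisfies the same equation with n lowered and j raised by one.
  induction n generalizing j g with
  | zero =>
    refine ⟨-g 0, (commute_apply_zero_of_eventually hg.continuousAt hc).neg_right, ?_⟩
    rw [Nat.zero_add, mul_neg, pow_succ_mul_apply_zero hg.continuousAt he]
    simp
  | succ n ih =>
    have hc0 := commute_apply_zero_of_eventually hg.continuousAt hc
    have h1 : a ^ (j + 1) * g 0 = 0 := by
      simpa using pow_succ_mul_apply_zero hg.continuousAt he
    obtain ⟨p, hp⟩ := hg
    have hd : AnalyticAt ℂ (dslope g 0) 0 := ⟨_, hp.has_fpower_series_dslope_fslope⟩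
    have hds : ∀ w ≠ 0, w • dslope g 0 w = g w - g 0 := fun w hw => by
      simpa using sub_smul_dslope g 0 w
    have hdc : ∀ᶠ w in 𝓝[≠] 0, Commute a (dslope g 0 w) := by
      filter_upwards [hc, self_mem_nhdsWithin] with w hw hne
      have : dslope g 0 w = w⁻¹ • (g w - g 0) := by
        rw [← hds w hne, smul_smul, inv_mul_cancel₀ hne, one_smul]
      rw [this]
      exact (hw.sub_right hc0).smul_right _
    have hde : ∀ᶠ w in 𝓝[≠] 0, (algebraMap ℂ A w - a) * (a ^ (j + 1) * dslope g 0 w)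
        = w ^ n • a ^ (j + 1) := by
      filter_upwards [he, self_mem_nhdsWithin] with w hw hne
      have hne : w ≠ 0 := hne
      have h2 : w • ((algebraMap ℂ A w - a) * (a ^ (j + 1) * dslope g 0 w)) =
          w • w ^ n • a ^ (j + 1) := by
        rw [← mul_smul_comm, ← mul_smul_comm, hds w hne, mul_sub, h1, sub_zero, smul_smul,
          ← pow_succ', pow_succ', mul_assoc, ← mul_assoc, sub_mul, Algebra.commutes, ← mul_sub,
          mul_assoc, hw, mul_smul_comm]
      simpa [hne] using h2
    obtain ⟨b, hb, hbe⟩ := ih (j + 1) (dslope g 0) hd hdc hde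
    exact ⟨b, hb, by rwa [show n + 1 + j = n + (j + 1) by ring]⟩

variable {A : Type*} [NormedRing A] [NormedAlgebra ℂ A] [CompleteSpace A]

/-- If `a` is Drazin invertible, then `w ^ m (w - a)⁻¹` extends analytically to `0` for some
`m`. -/
theorem IsDrazinInvertible.exists_analyticAt {a : A} (h : IsDrazinInvertible a) :
    ∃ (m : ℕ) (H : ℂ → A), AnalyticAt ℂ H 0 ∧ ∀ᶠ w in 𝓝 0, Commute a (H w) ∧
      (algebraMap ℂ A w - a) * H w = algebraMap ℂ A (w ^ m) := by
  obtain ⟨m, b, hb, hm⟩ := h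
  have hba : Commute b a := hb a (.refl a)
  have hlin : AnalyticAt ℂ (fun w : ℂ => w • b) 0 := analyticAt_id.smul analyticAt_const
  have hinv : AnalyticAt ℂ (fun w : ℂ => Ring.inverse (1 - w • b)) 0 :=
    AnalyticAt.fun_comp (g := fun x : A => Ring.inverse (1 - x)) (f := fun w : ℂ => w • b)
      (by simpa using analyticAt_inverse_one_sub ℂ A) hlin
  have hunit : ∀ᶠ w : ℂ in 𝓝 0, IsUnit (1 - w • b) := by
    have hc : ContinuousAt (fun w : ℂ => 1 - w • b) 0 := by fun_prop
    exact hc.eventually_mem (Units.isOpen.mem_nhds (by simp))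
  -- The sum times w - a is w^m - a^m. The second term restores a^m, since a^(m+1) b = a^m gives (w
  -- - a) a^m b = -a^m (1 - w b).
  refine ⟨m, fun w => ∑ i ∈ Finset.range m, algebraMap ℂ A w ^ i * a ^ (m - 1 - i) -
    a ^ m * b * Ring.inverse (1 - w • b), ?_, ?_⟩
  · refine AnalyticAt.sub ?_ (analyticAt_const.mul hinv)
    refine Finset.analyticAt_fun_sum _ fun i _ => ?_
    refine AnalyticAt.mul (AnalyticAt.pow ?_ _) analyticAt_const
    exact (Algebra.linearMap ℂ A).toContinuousLinearMap.analyticAt 0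
  · filter_upwards [hunit] with w hw
    obtain ⟨u, hu⟩ := hw
    have hau : Commute a (u : A) := by
      rw [hu]; exact (Commute.one_right a).sub_right (hba.symm.smul_right w)
    rw [← hu, Ring.inverse_unit]
    constructor
    · refine Commute.sub_right (Commute.sum_right _ _ _ fun i _ => ?_) ?_
      · exact Commute.mul_right (Commute.pow_right (Algebra.commutes w a).symm i)
          ((Commute.refl a).pow_right _)
      · exact (((Commute.refl a).pow_right m).mul_right hba.symm).mul_right hau.units_inv_right
    · rw [mul_sub, Commute.mul_geom_sum₂ (Algebra.commutes w a)]
      have : (algebraMap ℂ A w - a) * (a ^ m * b) = -(a ^ m * u) := by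
        rw [hu, sub_mul, ← mul_assoc a, ← pow_succ', ← hm, mul_sub, mul_one, mul_smul_comm,
          Algebra.smul_def]
        abel
      rw [← mul_assoc, this, neg_mul, mul_assoc, Units.mul_inv, map_pow]
      simp

theorem tendsto_sub_nhdsNE (z : ℂ) : Tendsto (fun μ : ℂ => μ - z) (𝓝[≠] z) (𝓝[≠] 0) := by
  refine tendsto_nhdsWithin_iff.2 ⟨?_, ?_⟩
  · exact Tendsto.mono_left (by simpa using (continuous_sub_right z).tendsto z) nhdsWithin_le_nhds
  · filter_upwards [self_mem_nhdsWithin] with μ hμ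
    simpa [sub_eq_zero] using hμ

theorem IsDrazinInvertible.eventually_resolvent {T : A} {z : ℂ}
    (h : IsDrazinInvertible (T - algebraMap ℂ A z)) :
    ∃ (m : ℕ) (H : ℂ → A), AnalyticAt ℂ H 0 ∧ ∀ᶠ μ in 𝓝[≠] z, μ ∈ resolventSet ℂ T ∧
      resolvent T μ = ((μ - z) ^ m)⁻¹ • H (μ - z) := by
  obtain ⟨m, H, hH, hev⟩ := h.exists_analyticAt
  refine ⟨m, H, hH, ?_⟩
  filter_upwards [(tendsto_sub_nhdsNE z).eventually (nhdsWithin_le_nhds hev),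
    self_mem_nhdsWithin] with μ hμ hne
  obtain ⟨hcomm, hmul⟩ := hμ
  have hne' : (μ - z) ^ m ≠ 0 := pow_ne_zero _ (sub_ne_zero.2 hne)
  have heq : algebraMap ℂ A (μ - z) - (T - algebraMap ℂ A z) = algebraMap ℂ A μ - T := by
    rw [map_sub]; abel
  have hcomm' : Commute (algebraMap ℂ A μ - T) (H (μ - z)) := by
    rw [← heq]; exact Commute.sub_left (Algebra.commutes _ _) hcomm
  rw [heq] at hmul
  have h1 : (algebraMap ℂ A μ - T) * (((μ - z) ^ m)⁻¹ • H (μ - z)) = 1 := by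
    rw [mul_smul_comm, hmul, Algebra.algebraMap_eq_smul_one, smul_smul, inv_mul_cancel₀ hne',
      one_smul]
  have h2 : (((μ - z) ^ m)⁻¹ • H (μ - z)) * (algebraMap ℂ A μ - T) = 1 := by
    rw [← (hcomm'.smul_right _).eq, h1]
  refine ⟨spectrum.mem_resolventSet_of_left_right_inverse h1 h2, ?_⟩
  exact Ring.inverse_unit ⟨_, _, h1, h2⟩

theorem IsDrazinInvertible.not_accPt {T : A} {z : ℂ}
    (h : IsDrazinInvertible (T - algebraMap ℂ A z)) : ¬ AccPt z (𝓟 (spectrum ℂ T)) := by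
  obtain ⟨m, H, -, hev⟩ := h.eventually_resolvent
  rw [accPt_iff_frequently_nhdsNE, not_frequently]
  filter_upwards [hev] with μ hμ
  exact fun hs => hs hμ.1

theorem IsDrazinInvertible.meromorphicAt_resolvent {T : A} {z : ℂ}
    (h : IsDrazinInvertible (T - algebraMap ℂ A z)) :
    MeromorphicAt (fun μ : ℂ => resolvent T μ) z := by
  obtain ⟨m, H, hH, hev⟩ := h.eventually_resolvent
  have hH' : AnalyticAt ℂ (fun μ => H (μ - z)) z :=
    AnalyticAt.fun_comp (by simpa using hH) (by fun_prop)
  have : MeromorphicAt (fun μ => ((μ - z) ^ m)⁻¹ • H (μ - z)) z := by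
    refine MeromorphicAt.fun_smul ?_ hH'.meromorphicAt
    exact MeromorphicAt.fun_inv (AnalyticAt.meromorphicAt (by fun_prop))
  refine this.congr ?_
  filter_upwards [hev] with μ hμ
  exact hμ.2.symm

/-- With nonnegative order the resolvent would have a limit at z, and by continuity this limit would
invert z - T. -/
theorem IsDrazinInvertible.meromorphicOrderAt_resolvent_neg {T : A} {z : ℂ}
    (h : IsDrazinInvertible (T - algebraMap ℂ A z)) (hz : z ∈ spectrum ℂ T) :
    meromorphicOrderAt (fun μ : ℂ => resolvent T μ) z < 0 := by
  by_contra hle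
  obtain ⟨c, hc⟩ := (tendsto_nhds_iff_meromorphicOrderAt_nonneg h.meromorphicAt_resolvent).2
    (not_lt.1 hle)
  obtain ⟨m, H, -, hev⟩ := h.eventually_resolvent
  have hcont : Tendsto (fun μ : ℂ => algebraMap ℂ A μ - T) (𝓝[≠] z) (𝓝 (algebraMap ℂ A z - T)) :=
    Tendsto.mono_left (Continuous.tendsto
      ((continuous_algebraMap ℂ A).sub continuous_const) z) nhdsWithin_le_nhds
  have h1 : (algebraMap ℂ A z - T) * c = 1 := by
    refine tendsto_nhds_unique (hcont.mul hc) (tendsto_const_nhds.congr' ?_)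
    filter_upwards [hev] with μ hμ
    exact (Ring.mul_inverse_cancel _ hμ.1).symm
  have h2 : c * (algebraMap ℂ A z - T) = 1 := by
    refine tendsto_nhds_unique (hc.mul hcont) (tendsto_const_nhds.congr' ?_)
    filter_upwards [hev] with μ hμ
    exact (Ring.inverse_mul_cancel _ hμ.1).symm
  exact hz (spectrum.mem_resolventSet_of_left_right_inverse h1 h2)

end ResolventPoles

/-! ### Meromorphic and polynomially meromorphic operators. -/

section Meromorphic

variable {Y : Type*} [NormedAddCommGroup Y] [NormedSpace ℂ Y]

/-- Clearing the pole by w^n gives the equation of `pow_eq_of_analyticAt` with j = 0. Isolation of z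
ensures that `resolvent` is a true inverse near z, not the default value 0. -/
theorem IsResolventPole.isDrazinInvertible {T : Y →L[ℂ] Y} {z : ℂ} (h : IsResolventPole T z)
    (hz : ¬ AccPt z (𝓟 (spectrum ℂ T))) :
    IsDrazinInvertible (T - algebraMap ℂ (Y →L[ℂ] Y) z) := by
  obtain ⟨n, hn⟩ := h.1
  have hz' : ∀ᶠ μ in 𝓝[≠] z, μ ∈ resolventSet ℂ T := by
    rw [accPt_iff_frequently_nhdsNE, not_frequently] at hz
    filter_upwards [hz] with μ hμ
    simpa [spectrum] using hμ
  have hadd : Tendsto (fun w : ℂ => w + z) (𝓝[≠] 0) (𝓝[≠] z) := by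
    refine tendsto_nhdsWithin_iff.2 ⟨?_, ?_⟩
    · exact Tendsto.mono_left (by simpa using (continuous_add_const z).tendsto 0)
        nhdsWithin_le_nhds
    · filter_upwards [self_mem_nhdsWithin] with μ hμ
      simpa using hμ
  have hev := hadd.eventually hz'
  have heq (w : ℂ) : algebraMap ℂ (Y →L[ℂ] Y) w - (T - algebraMap ℂ (Y →L[ℂ] Y) z) =
      algebraMap ℂ (Y →L[ℂ] Y) (w + z) - T := by
    rw [map_add]; abel
  have hg : AnalyticAt ℂ (fun w => w ^ n • resolvent T (w + z)) 0 := by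
    have : AnalyticAt ℂ ((fun μ => (μ - z) ^ n • resolvent T μ) ∘ fun w => w + z) 0 :=
      AnalyticAt.comp (by simpa using hn) (by fun_prop)
    simpa [Function.comp_def] using this
  have hc : ∀ᶠ w in 𝓝[≠] 0,
      Commute (T - algebraMap ℂ (Y →L[ℂ] Y) z) (w ^ n • resolvent T (w + z)) := by
    filter_upwards [hev] with w hw
    refine Commute.smul_right ?_ _
    obtain ⟨u, hu⟩ := hw
    rw [resolvent, ← hu, Ring.inverse_unit]
    refine Commute.units_inv_right ?_
    rw [hu]
    exact Commute.sub_right (Algebra.commutes _ _).symm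
      ((Commute.refl T).sub_left (Algebra.commutes _ _))
  have he : ∀ᶠ w in 𝓝[≠] 0, (algebraMap ℂ (Y →L[ℂ] Y) w - (T - algebraMap ℂ (Y →L[ℂ] Y) z)) *
      ((T - algebraMap ℂ (Y →L[ℂ] Y) z) ^ 0 * (w ^ n • resolvent T (w + z))) =
      w ^ n • (T - algebraMap ℂ (Y →L[ℂ] Y) z) ^ 0 := by
    filter_upwards [hev] with w hw
    rw [pow_zero, one_mul, heq, mul_smul_comm]
    congr 1
    exact Ring.mul_inverse_cancel _ hw
  obtain ⟨b, hb, hbe⟩ := pow_eq_of_analyticAt _ n 0 _ hg hc he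
  exact .of_commute hb (by simpa using hbe)

variable [CompleteSpace Y]

/-- Points off the spectrum give units, and isolated nonzero spectral points are poles. Conversely,
the local form of the resolvent at a Drazin point yields both isolation and the pole. All later use
of meromorphy goes through this algebraic form. -/
theorem isMeromorphicOperator_iff {T : Y →L[ℂ] Y} : IsMeromorphicOperator T ↔
    ∀ z : ℂ, z ≠ 0 → IsDrazinInvertible (T - algebraMap ℂ (Y →L[ℂ] Y) z) := by
  constructor
  · rintro ⟨h1, h2⟩ z hz
    have hacc : ¬ AccPt z (𝓟 (spectrum ℂ T)) := fun h => hz (h1 z h)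
    by_cases hs : z ∈ spectrum ℂ T
    · exact (h2 z hs hz hacc).isDrazinInvertible hacc
    · rw [← isDrazinInvertible_neg_iff, neg_sub]
      exact (spectrum.notMem_iff.1 hs).isDrazinInvertible
  · intro h
    refine ⟨fun z hz => ?_, fun z hz hz0 _ => ?_⟩
    · by_contra hz0
      exact (h z hz0).not_accPt hz
    · exact ⟨(h z hz0).meromorphicAt_resolvent, (h z hz0).meromorphicOrderAt_resolvent_neg hz⟩

/-- The set of `z` for which `T - z` is not Drazin invertible. -/
def drazinSpectrum {A : Type*} [Ring A] [Algebra ℂ A] (T : A) : Set ℂ :=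
  {z | ¬ IsDrazinInvertible (T - algebraMap ℂ A z)}

theorem isPolynomiallyMeromorphic_iff {T : Y →L[ℂ] Y} :
    IsPolynomiallyMeromorphic T ↔ (drazinSpectrum T).Finite := by
  have key (P : ℂ[X]) (w : ℂ) : aeval T (P - C w) = aeval T P - algebraMap ℂ (Y →L[ℂ] Y) w := by
    simp
  constructor
  · rintro ⟨P, hP, hm⟩
    rw [isMeromorphicOperator_iff] at hm
    have hP0 : P ≠ 0 := by rintro rfl; simp at hP
    refine (P.rootSet_finite ℂ).subset fun z hz => ?_
    rw [mem_rootSet]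
    refine ⟨hP0, ?_⟩
    by_contra hne
    -- Subtracting P(z) ≠ 0 makes z a root and stays within the Drazin invertible values of P(T).
    refine hz (isDrazinInvertible_sub_of_isRoot T (P := P - C (P.eval z)) ?_ (by simp) ?_)
    · intro h0
      rw [sub_eq_zero] at h0
      rw [h0] at hP
      simp at hP
    · rw [key]
      exact hm _ (by simpa using hne)
  · intro h
    -- This polynomial vanishes on `drazinSpectrum T`, so for w ≠ 0 no root of P - w lies there. The
    -- factor X keeps it nonconstant when that set is empty.
    refine ⟨X * ∏ d ∈ h.toFinset, (X - C d), ?_, ?_⟩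
    · rw [natDegree_mul X_ne_zero (Finset.prod_ne_zero_iff.2 fun d _ => X_sub_C_ne_zero d)]
      simp
    · rw [isMeromorphicOperator_iff]
      intro w hw
      rw [← key]
      refine isDrazinInvertible_aeval T ?_ fun t ht => ?_
      · intro h0
        have := congrArg natDegree h0
        rw [natDegree_sub_C, natDegree_mul X_ne_zero
          (Finset.prod_ne_zero_iff.2 fun d _ => X_sub_C_ne_zero d)] at this
        simp at this
      · by_contra hd
        have hd' : t ∈ h.toFinset := h.mem_toFinset.2 hd
        have : (X * ∏ d ∈ h.toFinset, (X - C d)).eval t = 0 := by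
          rw [eval_mul, eval_prod, Finset.prod_eq_zero hd' (by simp), mul_zero]
        rw [IsRoot, eval_sub, this] at ht
        simp at ht
        exact hw ht

/-- If the resolvent at one point is polynomially meromorphic, then so is the operator. -/
theorem HasGeneralizedMeromorphicResolvent.isPolynomiallyMeromorphic {T : Y →L[ℂ] Y}
    (h : HasGeneralizedMeromorphicResolvent T) : IsPolynomiallyMeromorphic T := by
  obtain ⟨z, hz, hR⟩ := h
  rw [isPolynomiallyMeromorphic_iff] at hR ⊢
  have hu : IsUnit (T - algebraMap ℂ (Y →L[ℂ] Y) z) := by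
    simpa using (spectrum.mem_resolventSet_iff.1 hz).neg
  obtain ⟨u, hu⟩ := hu
  rw [← hu, Ring.inverse_unit] at hR
  -- With 0⁻¹ = 0 this map is injective on all of ℂ, so the preimage of a finite set is finite.
  refine (hR.preimage (f := fun t : ℂ => (t - z)⁻¹) ?_).subset fun t ht => ?_
  · intro s _ t _ hst
    simpa using hst
  · show ¬ _
    intro hd
    refine ht ?_
    have htz : t - z ≠ 0 := by
      intro h0
      refine ht ?_
      rw [sub_eq_zero.1 h0, ← hu]
      exact u.isUnit.isDrazinInvertible
    have hT : T - algebraMap ℂ (Y →L[ℂ] Y) t = u - algebraMap ℂ (Y →L[ℂ] Y) (t - z) := by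
      rw [hu, map_sub]; abel
    have hfac : (T - algebraMap ℂ (Y →L[ℂ] Y) t) =
        ((↑u⁻¹ : Y →L[ℂ] Y) - algebraMap ℂ (Y →L[ℂ] Y) (t - z)⁻¹) * (-(t - z) • (u : Y →L[ℂ] Y)) := by
      rw [hT, mul_smul_comm, sub_mul, Units.inv_mul, Algebra.algebraMap_eq_smul_one,
        Algebra.algebraMap_eq_smul_one, smul_mul_assoc, one_mul, smul_sub, smul_smul,
        neg_mul, mul_inv_cancel₀ htz, neg_smul, neg_smul, one_smul]
      abel
    rw [hfac]
    have hcu : Commute ((↑u⁻¹ : Y →L[ℂ] Y) - algebraMap ℂ (Y →L[ℂ] Y) (t - z)⁻¹)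
        (-(t - z) • (u : Y →L[ℂ] Y)) := by
      refine Commute.smul_right (Commute.sub_left ?_ (Algebra.commutes (t - z)⁻¹ (u : Y →L[ℂ] Y))) _
      exact (Commute.refl (u : Y →L[ℂ] Y)).units_inv_left
    refine hd.mul (IsUnit.isDrazinInvertible ?_) hcu
    rw [Algebra.smul_def]
    exact ((isUnit_iff_ne_zero.2 (neg_ne_zero.2 htz)).map (algebraMap ℂ _)).mul u.isUnit

end Meromorphic

/-! ### Circle integrals of vector-valued functions. -/

section CircleIntegrals

theorem ContinuousLinearMap.map_circleIntegral {E F : Type*} [NormedAddCommGroup E]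
    [NormedSpace ℂ E] [CompleteSpace E] [NormedAddCommGroup F] [NormedSpace ℂ F] [CompleteSpace F]
    (L : E →L[ℂ] F) {f : ℂ → E} {d : ℂ} {r : ℝ} (hr : 0 ≤ r)
    (hf : ContinuousOn f (Metric.sphere d r)) :
    L (circleIntegral f d r) = circleIntegral (fun z => L (f z)) d r := by
  rw [circleIntegral, circleIntegral, ← L.intervalIntegral_comp_comm (hf.circleIntegrable hr).out]
  simp

theorem circleIntegral_comm {E : Type*} [NormedAddCommGroup E] [NormedSpace ℂ E]
    {f : ℂ → ℂ → E} {c d : ℂ} {r s : ℝ} (hr : 0 ≤ r) (hs : 0 ≤ s)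
    (hf : ContinuousOn (Function.uncurry f) (Metric.sphere c r ×ˢ Metric.sphere d s)) :
    circleIntegral (fun x => circleIntegral (fun y => f x y) d s) c r =
      circleIntegral (fun y => circleIntegral (fun x => f x y) c r) d s := by
  simp only [circleIntegral, ← intervalIntegral.integral_smul]
  rw [MeasureTheory.intervalIntegral_intervalIntegral_swap]
  · simp only [smul_smul, mul_comm]
  · have hcont : Continuous fun q : ℝ × ℝ => f (circleMap c r q.1) (circleMap d s q.2) := by
      have h1 : Continuous fun q : ℝ × ℝ => (circleMap c r q.1, circleMap d s q.2) :=
        ((continuous_circleMap c r).comp continuous_fst).prodMk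
          ((continuous_circleMap d s).comp continuous_snd)
      exact hf.comp_continuous h1 fun q =>
        ⟨circleMap_mem_sphere _ hr _, circleMap_mem_sphere _ hs _⟩
    have hcont' : Continuous (Function.uncurry fun x y : ℝ => deriv (circleMap c r) x •
        deriv (circleMap d s) y • f (circleMap c r x) (circleMap d s y)) := by
      simp only [deriv_circleMap, Function.uncurry_def]
      refine Continuous.smul ?_ (Continuous.smul ?_ hcont)
      · exact ((continuous_circleMap 0 r).comp continuous_fst).mul continuous_const
      · exact ((continuous_circleMap 0 s).comp continuous_snd).mul continuous_const
    refine (hcont'.continuousOn.integrableOn_compact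
      (K := Set.uIcc 0 (2 * Real.pi) ×ˢ Set.uIcc 0 (2 * Real.pi))
      (isCompact_uIcc.prod isCompact_uIcc)).mono_set ?_
    exact Set.prod_mono Set.uIoc_subset_uIcc Set.uIoc_subset_uIcc

theorem circleIntegral_inv_sub_of_mem_ball {d μ : ℂ} {r : ℝ} (h : μ ∈ Metric.ball d r) :
    (2 * Real.pi * Complex.I)⁻¹ • circleIntegral (fun z => (μ - z)⁻¹) d r = (-1 : ℂ) := by
  have h1 : (fun z => (μ - z)⁻¹) = fun z => (-1 : ℂ) • (z - μ)⁻¹ := by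
    funext z; rw [← neg_sub, inv_neg]; simp
  rw [h1, circleIntegral.integral_smul, circleIntegral.integral_sub_inv_of_mem_ball h]
  have := Complex.two_pi_I_ne_zero
  rw [smul_eq_mul, smul_eq_mul]; field_simp

theorem circleIntegral_inv_sub_of_notMem_closedBall {d μ : ℂ} {r : ℝ} (hr : 0 ≤ r)
    (h : μ ∉ Metric.closedBall d r) : circleIntegral (fun z => (μ - z)⁻¹) d r = 0 := by
  have hne : ∀ z ∈ Metric.closedBall d r, μ - z ≠ 0 := fun z hz h0 => by
    rw [sub_eq_zero.1 h0] at h; exact h hz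
  refine Complex.circleIntegral_eq_zero_of_differentiable_on_off_countable hr
    Set.countable_empty ?_ ?_
  · exact (continuousOn_const.sub continuousOn_id).inv₀ hne
  · intro z hz
    exact ((differentiableAt_const _).sub differentiableAt_id).inv
      (hne z (Metric.ball_subset_closedBall hz.1))

end CircleIntegrals

/-! ### The Riesz projection of a circle. -/

section RieszProjection

variable {A : Type*} [NormedRing A] [NormedAlgebra ℂ A]

/-- The Cauchy integral of the resolvent of `a` over a circle, with weight `f`. -/
noncomputable def resolventIntegral (a : A) (d : ℂ) (r : ℝ) (f : ℂ → ℂ) : A :=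
  (2 * Real.pi * Complex.I)⁻¹ • circleIntegral (fun z => f z • resolvent a z) d r

variable [CompleteSpace A] {a : A} {d : ℂ} {r : ℝ}

theorem continuousOn_resolvent (a : A) : ContinuousOn (resolvent a) (resolventSet ℂ a) :=
  fun _ hz => (spectrum.hasDerivAt_resolvent_const_left hz).continuousAt.continuousWithinAt

theorem commute_resolventIntegral (hr : 0 ≤ r) (hs : Metric.sphere d r ⊆ resolventSet ℂ a)
    {f : ℂ → ℂ} (hf : ContinuousOn f (Metric.sphere d r)) {x : A} (hx : Commute a x) :
    Commute (resolventIntegral a d r f) x := by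
  refine Commute.smul_left ?_ _
  have hc : ContinuousOn (fun z => f z • resolvent a z) (Metric.sphere d r) :=
    hf.smul ((continuousOn_resolvent a).mono hs)
  have h1 := ((ContinuousLinearMap.mul ℂ A x)).map_circleIntegral hr hc
  have h2 := ((ContinuousLinearMap.mul ℂ A).flip x).map_circleIntegral hr hc
  simp only [ContinuousLinearMap.mul_apply', ContinuousLinearMap.flip_apply] at h1 h2
  show _ * _ = _ * _
  rw [h1, h2]
  refine circleIntegral.integral_congr hr fun z hz => ?_
  have hu : IsUnit (algebraMap ℂ A z - a) := hs hz
  obtain ⟨u, hu⟩ := hu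
  show (f z • resolvent a z) * x = x * (f z • resolvent a z)
  refine Commute.smul_left ?_ _
  rw [resolvent, ← hu, Ring.inverse_unit]
  refine Commute.units_inv_left ?_
  rw [hu]
  exact Commute.sub_left (Algebra.commutes _ _) hx

/-- Under the integral, μ - a = (μ - z) + (z - a). The scalar term on the right is 0 for μ outside
the circle and -1 inside, which makes μ - a invertible on the range of the Riesz projection,
respectively of its complement. -/
theorem sub_mul_resolventIntegral (hr : 0 ≤ r) (hs : Metric.sphere d r ⊆ resolventSet ℂ a)
    {μ : ℂ} (hμ : μ ∉ Metric.sphere d r) :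
    (algebraMap ℂ A μ - a) * resolventIntegral a d r (fun z => (μ - z)⁻¹) =
      resolventIntegral a d r 1 + algebraMap ℂ A
        ((2 * Real.pi * Complex.I)⁻¹ • circleIntegral (fun z => (μ - z)⁻¹) d r) := by
  have hne : ∀ z ∈ Metric.sphere d r, μ - z ≠ 0 := fun z hz h0 => by
    rw [sub_eq_zero.1 h0] at hμ; exact hμ hz
  have hf : ContinuousOn (fun z => (μ - z)⁻¹) (Metric.sphere d r) :=
    (continuousOn_const.sub continuousOn_id).inv₀ hne
  have hR := (continuousOn_resolvent a).mono hs
  have h1 := ((ContinuousLinearMap.mul ℂ A (algebraMap ℂ A μ - a))).map_circleIntegral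
    (f := fun z => (μ - z)⁻¹ • resolvent a z) hr (hf.smul hR)
  simp only [ContinuousLinearMap.mul_apply'] at h1
  rw [resolventIntegral, resolventIntegral, mul_smul_comm, h1, smul_eq_mul, map_mul,
    ← Algebra.smul_def, ← smul_add]
  congr 1
  have h2 : algebraMap ℂ A (circleIntegral (fun z => (μ - z)⁻¹) d r) =
      circleIntegral (fun z => (μ - z)⁻¹ • (1 : A)) d r := by
    rw [circleIntegral.integral_smul_const, Algebra.algebraMap_eq_smul_one]
  rw [h2, ← circleIntegral.integral_add]
  · refine circleIntegral.integral_congr hr fun z hz => ?_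
    have hu := Ring.mul_inverse_cancel _ (hs hz : IsUnit (algebraMap ℂ A z - a))
    have h3 : algebraMap ℂ A μ - a = algebraMap ℂ A (μ - z) + (algebraMap ℂ A z - a) := by
      rw [map_sub]; abel
    show (algebraMap ℂ A μ - a) * ((μ - z)⁻¹ • resolvent a z) =
      (1 : ℂ) • resolvent a z + (μ - z)⁻¹ • (1 : A)
    rw [mul_smul_comm, h3, add_mul, smul_add, ← Algebra.smul_def, smul_smul,
      inv_mul_cancel₀ (hne z hz)]
    congr 2
  · exact ContinuousOn.circleIntegrable hr (continuousOn_const.smul hR)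
  · exact ContinuousOn.circleIntegrable hr (hf.smul continuousOn_const)

theorem resolventIntegral_eq_of_annulus {s : ℝ} (hr : 0 < r) (hrs : r ≤ s)
    (hs : Metric.closedBall d s \ Metric.ball d r ⊆ resolventSet ℂ a) :
    resolventIntegral a d s 1 = resolventIntegral a d r 1 := by
  rw [resolventIntegral, resolventIntegral]
  congr 1
  refine Complex.circleIntegral_eq_of_differentiable_on_annulus_off_countable hr hrs
    Set.countable_empty ?_ ?_
  · exact (continuousOn_const (c := (1 : ℂ))).smul ((continuousOn_resolvent a).mono hs)
  · intro z hz
    exact (differentiableAt_const (1 : ℂ)).smul (spectrum.hasDerivAt_resolvent_const_left (hs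
      ⟨Metric.ball_subset_closedBall hz.1.1, fun h => hz.1.2 (Metric.ball_subset_closedBall h)⟩)
      ).differentiableAt

theorem exists_annulus_subset (hr : 0 < r) (hs : Metric.sphere d r ⊆ resolventSet ℂ a) :
    ∃ s > r, Metric.closedBall d s \ Metric.ball d r ⊆ resolventSet ℂ a := by
  obtain ⟨δ, hδ, hsub⟩ := (isCompact_sphere d r).exists_thickening_subset_open
    (spectrum.isOpen_resolventSet a) hs
  refine ⟨r + δ / 2, by linarith, fun z hz => hsub (Metric.mem_thickening_iff.2 ?_)⟩
  have h1 : ‖z - d‖ ≤ r + δ / 2 := by simpa [dist_eq_norm] using hz.1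
  have h2 : r ≤ ‖z - d‖ := by simpa [dist_eq_norm] using hz.2
  have h0 : 0 < ‖z - d‖ := hr.trans_le h2
  -- The radial projection of z to the circle.
  refine ⟨d + (r / ‖z - d‖ : ℝ) • (z - d), ?_, ?_⟩
  · rw [mem_sphere_iff_norm, add_sub_cancel_left, norm_smul, Real.norm_of_nonneg (by positivity),
      div_mul_cancel₀ _ h0.ne']
  · have h3 : z - (d + (r / ‖z - d‖ : ℝ) • (z - d)) = (1 - r / ‖z - d‖ : ℝ) • (z - d) := by
      rw [sub_smul, one_smul]; abel
    have h4 : 0 ≤ 1 - r / ‖z - d‖ := by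
      rw [sub_nonneg, div_le_one h0]; exact h2
    rw [dist_eq_norm, h3, norm_smul, Real.norm_of_nonneg h4, sub_mul, one_mul,
      div_mul_cancel₀ _ h0.ne']
    linarith

/-- The second factor of p p is moved to a slightly larger circle. For z on it, p times the
resolvent at z is a Cauchy integral over the small circle; after exchanging the integrals, Cauchy's
formula for the outer one returns p. -/
theorem isIdempotentElem_resolventIntegral (hr : 0 < r)
    (hs : Metric.sphere d r ⊆ resolventSet ℂ a) :
    IsIdempotentElem (resolventIntegral a d r 1) := by
  obtain ⟨s, hrs, hann⟩ := exists_annulus_subset hr hs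
  have hs' : Metric.sphere d s ⊆ resolventSet ℂ a := fun z hz =>
    hann ⟨Metric.sphere_subset_closedBall hz, fun h => by
      rw [Metric.mem_ball, Metric.mem_sphere.1 hz] at h; linarith⟩
  have hs0 : 0 < s := hr.trans hrs
  set p := resolventIntegral a d r 1 with hp
  set k : ℂ := (2 * Real.pi * Complex.I)⁻¹ with hk
  have hR := (continuousOn_resolvent a).mono hs
  have hR' := (continuousOn_resolvent a).mono hs'
  have hne : ∀ x ∈ Metric.sphere d s, ∀ y ∈ Metric.sphere d r, x - y ≠ 0 := by
    intro x hx y hy h0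
    rw [sub_eq_zero.1 h0, Metric.mem_sphere, Metric.mem_sphere.1 hy] at hx
    linarith
  have key : ∀ z ∈ Metric.sphere d s, p * resolvent a z =
      resolventIntegral a d r fun y => (z - y)⁻¹ := by
    intro z hz
    have hzc : z ∉ Metric.closedBall d r := fun h => by
      rw [Metric.mem_closedBall, Metric.mem_sphere.1 hz] at h; linarith
    have h1 := sub_mul_resolventIntegral hr.le hs (μ := z)
      fun h => hzc (Metric.sphere_subset_closedBall h)
    rw [circleIntegral_inv_sub_of_notMem_closedBall hr.le hzc, smul_zero, map_zero, add_zero,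
      ← hp] at h1
    have h2 : Commute (resolventIntegral a d r fun y => (z - y)⁻¹) (algebraMap ℂ A z - a) :=
      commute_resolventIntegral hr.le hs
        ((continuousOn_const.sub continuousOn_id).inv₀ (hne z hz))
        (Commute.sub_right (Algebra.commutes _ _).symm (.refl a))
    rw [← h1, ← h2.eq, mul_assoc, resolvent, Ring.mul_inverse_cancel _ (hs' hz), mul_one]
  have h3 : p * p = k • circleIntegral (fun z => p * resolvent a z) d s := by
    nth_rw 2 [hp]
    rw [← resolventIntegral_eq_of_annulus hr hrs.le hann, resolventIntegral, mul_smul_comm]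
    congr 1
    have := ((ContinuousLinearMap.mul ℂ A p)).map_circleIntegral hs0.le hR'
    simpa using this
  show p * p = p
  rw [h3, circleIntegral.integral_congr hs0.le key]
  simp only [resolventIntegral]
  rw [circleIntegral.integral_smul, circleIntegral_comm hs0.le hr.le]
  · have h4 : Set.EqOn (fun y => circleIntegral (fun x => (x - y)⁻¹ • resolvent a y) d s)
        (fun y => k⁻¹ • resolvent a y) (Metric.sphere d r) := by
      intro y hy
      show circleIntegral (fun x => (x - y)⁻¹ • resolvent a y) d s = k⁻¹ • resolvent a y
      rw [circleIntegral.integral_smul_const, circleIntegral.integral_sub_inv_of_mem_ball, hk,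
        inv_inv]
      rw [Metric.mem_ball, Metric.mem_sphere.1 hy]
      exact hrs
    have hk0 : k ≠ 0 := inv_ne_zero Complex.two_pi_I_ne_zero
    rw [circleIntegral.integral_congr hr.le h4, circleIntegral.integral_smul, smul_smul k k⁻¹,
      mul_inv_cancel₀ hk0, one_smul, hp, resolventIntegral]
    simp only [Pi.one_apply, one_smul, hk]
  · refine ContinuousOn.smul (ContinuousOn.inv₀ (by fun_prop) fun q hq => hne _ hq.1 _ hq.2) ?_
    exact hR.comp continuousOn_snd fun q hq => hq.2

/-- The Riesz projection associated to the part of the spectrum inside a circle. -/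
theorem exists_riesz_idempotent (hr : 0 < r) (hs : Metric.sphere d r ⊆ resolventSet ℂ a) :
    ∃ p : A, IsIdempotentElem p ∧ (∀ x, Commute a x → Commute p x) ∧
      (∀ μ ∉ Metric.closedBall d r, ∃ c, (∀ x, Commute a x → Commute c x) ∧
        (a - algebraMap ℂ A μ) * c = p) ∧
      ∀ μ ∈ Metric.ball d r, ∃ c, (∀ x, Commute a x → Commute c x) ∧
        (a - algebraMap ℂ A μ) * c = 1 - p := by
  refine ⟨resolventIntegral a d r 1, isIdempotentElem_resolventIntegral hr hs,
    fun x hx => commute_resolventIntegral hr.le hs continuousOn_const hx, ?_, ?_⟩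
  · intro μ hμ
    have hμ' : μ ∉ Metric.sphere d r := fun h => hμ (Metric.sphere_subset_closedBall h)
    refine ⟨-resolventIntegral a d r fun y => (μ - y)⁻¹, fun x hx => Commute.neg_left ?_, ?_⟩
    · exact commute_resolventIntegral hr.le hs ((continuousOn_const.sub continuousOn_id).inv₀
        fun z hz => sub_ne_zero.2 fun (h0 : μ = z) => hμ' (h0 ▸ hz)) hx
    · rw [mul_neg, ← neg_mul, neg_sub, sub_mul_resolventIntegral hr.le hs hμ',
        circleIntegral_inv_sub_of_notMem_closedBall hr.le hμ]
      simp
  · intro μ hμ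
    have hμ' : μ ∉ Metric.sphere d r := fun h => by
      rw [Metric.mem_ball, Metric.mem_sphere.1 h] at hμ; exact lt_irrefl _ hμ
    refine ⟨resolventIntegral a d r fun y => (μ - y)⁻¹, fun x hx => ?_, ?_⟩
    · exact commute_resolventIntegral hr.le hs ((continuousOn_const.sub continuousOn_id).inv₀
        fun z hz => sub_ne_zero.2 fun (h0 : μ = z) => hμ' (h0 ▸ hz)) hx
    · rw [← neg_sub, neg_mul, sub_mul_resolventIntegral hr.le hs hμ',
        circleIntegral_inv_sub_of_mem_ball hμ, map_neg, map_one]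
      abel

end RieszProjection

/-! ### Limits of invertible operators. -/

section LimitsOfInvertibles

variable {E : Type*} [NormedAddCommGroup E] [NormedSpace ℂ E]

theorem sub_algebraMap_apply (S : E →L[ℂ] E) (z : ℂ) (x : E) :
    (S - algebraMap ℂ (E →L[ℂ] E) z) x = S x - z • x := by
  simp [Algebra.algebraMap_eq_smul_one]

theorem exists_small_of_frequently_nhdsNE {p : ℂ → Prop} (h : ∃ᶠ z in 𝓝[≠] 0, p z) (C : ℝ) :
    ∃ z, z ≠ 0 ∧ ‖z‖ * C < 1 ∧ p z := by
  have h1 : ∀ᶠ z : ℂ in 𝓝[≠] 0, ‖z‖ * C < 1 := by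
    have : ContinuousAt (fun z : ℂ => ‖z‖ * C) 0 := by fun_prop
    exact nhdsWithin_le_nhds (this.eventually_lt continuousAt_const (by simp))
  obtain ⟨z, hz, hz', hz0⟩ := (h.and_eventually (h1.and self_mem_nhdsWithin)).exists
  exact ⟨z, hz0, hz', hz⟩

variable [CompleteSpace E]

/-- A surjective operator which is a limit of invertible operators `S - z` is injective. -/
theorem injective_of_surjective_of_frequently_isUnit {S : E →L[ℂ] E}
    (hS : Function.Surjective S)
    (h : ∃ᶠ z in 𝓝[≠] 0, IsUnit (S - algebraMap ℂ (E →L[ℂ] E) z)) : Function.Injective S := by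
  obtain ⟨C, hC, hpre⟩ := S.exists_preimage_norm_le hS
  -- C is the open mapping constant. From ‖G‖ ≤ C + ‖z‖ C ‖G‖ and ‖z‖ C < 1/2 follows ‖G‖ ≤ 2C; a
  -- kernel vector satisfies x = -z G x, and ‖z‖ 2C < 1 forces x = 0.
  obtain ⟨z, hz0, hzC, u, hu⟩ := exists_small_of_frequently_nhdsNE h (2 * C)
  set G : E →L[ℂ] E := ↑u⁻¹
  have hGS (x : E) : G (S x) = x + z • G x := by
    have h1 : G * (u : E →L[ℂ] E) = 1 := u.inv_mul
    have h2 := DFunLike.congr_fun h1 x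
    rw [hu, mul_apply_eq_comp, sub_algebraMap_apply, map_sub, map_smul] at h2
    rw [← sub_eq_iff_eq_add]; simpa using h2
  have hb : ‖G‖ ≤ C + ‖z‖ * C * ‖G‖ := by
    refine G.opNorm_le_bound (by positivity) fun y => ?_
    obtain ⟨x, hx, hxn⟩ := hpre y
    calc ‖G y‖ = ‖x + z • G x‖ := by rw [← hx, hGS]
      _ ≤ ‖x‖ + ‖z‖ * (‖G‖ * ‖x‖) := (norm_add_le _ _).trans (by
          rw [norm_smul]; gcongr; exact G.le_opNorm x)
      _ ≤ C * ‖y‖ + ‖z‖ * (‖G‖ * (C * ‖y‖)) := by gcongr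
      _ = (C + ‖z‖ * C * ‖G‖) * ‖y‖ := by ring
  have hb2 : ‖G‖ ≤ 2 * C := by nlinarith [norm_nonneg G]
  rw [injective_iff_map_eq_zero]
  intro x hx
  have h1 : x = -(z • G x) := by
    have := hGS x
    rw [hx, map_zero] at this
    exact eq_neg_of_add_eq_zero_left this.symm
  have h2 : ‖x‖ ≤ ‖z‖ * (2 * C * ‖x‖) := by
    calc ‖x‖ = ‖z‖ * ‖G x‖ := by nth_rw 1 [h1]; rw [norm_neg, norm_smul]
      _ ≤ ‖z‖ * (2 * C * ‖x‖) := by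
        gcongr; exact (G.le_opNorm x).trans (by gcongr)
  by_contra hx0
  have : 0 < ‖x‖ := norm_pos_iff.2 hx0
  nlinarith

/-- An operator which is bounded below and is a limit of invertible operators `S - z` is
invertible. -/
theorem isUnit_of_antilipschitz_of_frequently_isUnit {S : E →L[ℂ] E} {K : NNReal}
    (hS : AntilipschitzWith K S)
    (h : ∃ᶠ z in 𝓝[≠] 0, IsUnit (S - algebraMap ℂ (E →L[ℂ] E) z)) : IsUnit S := by
  obtain ⟨z, hz0, hzC, u, hu⟩ := exists_small_of_frequently_nhdsNE h (2 * K + 1)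
  set G : E →L[ℂ] E := ↑u⁻¹ with hG
  have hz1 := norm_nonneg z
  have hK := K.2
  have hb : ‖G‖ ≤ 2 * K := by
    refine G.opNorm_le_bound (by positivity) fun y => ?_
    have h1 : (u : E →L[ℂ] E) * G = 1 := u.mul_inv
    have h2 := DFunLike.congr_fun h1 y
    rw [hu, mul_apply_eq_comp, sub_algebraMap_apply] at h2
    have h3 : S (G y) = y + z • G y := sub_eq_iff_eq_add.1 h2
    have h4 : ‖G y‖ ≤ K * (‖y‖ + ‖z‖ * ‖G y‖) := by
      calc ‖G y‖ ≤ K * ‖S (G y)‖ := by simpa using hS.le_mul_dist (G y) 0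
        _ ≤ _ := by rw [h3, ← norm_smul]; gcongr; exact norm_add_le _ _
    have h5 := norm_nonneg (G y)
    nlinarith [mul_nonneg hz1 h5]
  have h1 : ‖-(z • G)‖ < 1 := by
    rw [norm_neg, norm_smul]
    calc ‖z‖ * ‖G‖ ≤ ‖z‖ * (2 * K) := by gcongr
      _ < 1 := by nlinarith
  -- S = (S - z)(1 + z G), and the second factor is inverted by a Neumann series.
  have h2 : S = u * (1 - -(z • G)) := by
    rw [sub_neg_eq_add, mul_add, mul_one, mul_smul_comm, hG, Units.mul_inv, hu,
      Algebra.algebraMap_eq_smul_one]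
    abel
  rw [h2]
  exact u.isUnit.mul (isUnit_one_sub_of_norm_lt_one h1)

end LimitsOfInvertibles

/-! ### B-Fredholm operators and the B-Fredholm spectrum. -/

section BFredholm

variable {X : Type*} [NormedAddCommGroup X] [NormedSpace ℂ X]

/-- Invariance under S alone would not do: p must also be invariant under the inverse of S - z,
which commutes with S. -/
theorem isUnit_restrict_sub {S : X →L[ℂ] X} {p : Submodule ℂ X} (hp : ∀ x ∈ p, S x ∈ p)
    (hG : ∀ G : X →L[ℂ] X, Commute S G → ∀ x ∈ p, G x ∈ p) {z : ℂ}
    (hu : IsUnit (S - algebraMap ℂ (X →L[ℂ] X) z)) :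
    IsUnit (S.restrict hp - algebraMap ℂ (p →L[ℂ] p) z) := by
  obtain ⟨u, hu⟩ := hu
  have hc : Commute S (↑u⁻¹ : X →L[ℂ] X) := by
    refine Commute.units_inv_right ?_
    rw [hu]
    exact (Commute.refl S).sub_right (Algebra.commutes _ _).symm
  have happ (x : p) : ((S.restrict hp - algebraMap ℂ (p →L[ℂ] p) z) x : X) =
      (u : X →L[ℂ] X) (x : X) := by
    rw [hu, sub_algebraMap_apply, sub_algebraMap_apply]; rfl
  refine isUnit_iff_exists.2 ⟨(↑u⁻¹ : X →L[ℂ] X).restrict (hG _ hc), ?_, ?_⟩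
  · ext x
    rw [mul_apply_eq_comp, happ, ContinuousLinearMap.coe_restrict_apply,
      ← mul_apply_eq_comp, Units.mul_inv]
    rfl
  · ext x
    rw [mul_apply_eq_comp, ContinuousLinearMap.coe_restrict_apply, happ,
      ← mul_apply_eq_comp, Units.inv_mul]
    rfl

theorem mem_range_pow_of_commute {S G : X →L[ℂ] X} (h : Commute S G) (m : ℕ) :
    ∀ x ∈ (S ^ m).range, G x ∈ (S ^ m).range := by
  rintro _ ⟨y, rfl⟩
  exact ⟨G y, DFunLike.congr_fun (h.pow_left m).eq y⟩

theorem range_pow_antitone (S : X →L[ℂ] X) : Antitone fun j : ℕ => (S ^ j).range := by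
  refine antitone_nat_of_succ_le fun j => ?_
  rintro _ ⟨y, rfl⟩
  exact ⟨S y, by rw [pow_succ]; rfl⟩

theorem coe_restrictRangePow_pow_apply (S : X →L[ℂ] X) (m k : ℕ) (x : (S ^ m).range) :
    ((restrictRangePow S m ^ k) x : X) = (S ^ k) (x : X) := by
  induction k generalizing x with
  | zero => rfl
  | succ k ih =>
    rw [pow_succ, pow_succ, mul_apply_eq_comp, mul_apply_eq_comp, ih]
    rfl

/-- If A is the restriction of S to the range of S^m, then b = A^(-(m+1)) S^m satisfies S^(m+1) b =
S^m. -/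
theorem IsDrazinInvertible.of_isUnit_restrictRangePow {S : X →L[ℂ] X} {m : ℕ}
    (h : IsUnit (restrictRangePow S m)) : IsDrazinInvertible S := by
  obtain ⟨u, hu⟩ := h
  set b : (S ^ m).range →L[ℂ] (S ^ m).range := ↑u⁻¹ with hb
  have hcomm : Commute (restrictRangePow S m) b := by
    rw [← hu]; exact (Commute.refl (u : (S ^ m).range →L[ℂ] (S ^ m).range)).units_inv_right
  have hpow : restrictRangePow S m ^ (m + 1) * b ^ (m + 1) = 1 := by
    rw [← hcomm.mul_pow, ← hu, hb, Units.mul_inv, one_pow]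
  let σ : X →L[ℂ] (S ^ m).range := (S ^ m).rangeRestrict
  have hσ (x : X) : σ (S x) = restrictRangePow S m (σ x) := by
    ext
    show (S ^ m) (S x) = S ((S ^ m) x)
    exact DFunLike.congr_fun ((Commute.refl S).pow_left m).eq x
  refine IsDrazinInvertible.of_commute (m := m)
    (b := (S ^ m).range.subtypeL ∘L (b ^ (m + 1)) ∘L σ) ?_ ?_
  · ext x
    show S ((b ^ (m + 1)) (σ x) : X) = ((b ^ (m + 1)) (σ (S x)) : X)
    rw [hσ]
    have := DFunLike.congr_fun (hcomm.pow_right (m + 1)).eq (σ x)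
    exact congrArg Subtype.val this
  · ext x
    show (S ^ m) x = (S ^ (m + 1)) ((b ^ (m + 1)) (σ x) : X)
    rw [← coe_restrictRangePow_pow_apply, ← mul_apply_eq_comp, hpow]
    rfl

theorem ContinuousLinearMap.IsFredholm.pow {A : X →L[ℂ] X} (h : A.IsFredholm) (k : ℕ) :
    (A ^ k).IsFredholm := by
  obtain ⟨v, hv⟩ := h.exists_isQuasiInverse
  refine ContinuousLinearMap.IsFredholm.of_isQuasiInverse (v := v ^ k) ?_
  induction k with
  | zero => exact (LinearEquiv.refl ℂ X).isQuasiInverse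
  | succ k ih =>
    rw [pow_succ' v, pow_succ A]
    exact hv.comp ih

/-- The range of S^m is the fixed space of S^m b^m, hence closed, and b inverts S on it. -/
theorem IsDrazinInvertible.isBFredholm {S : X →L[ℂ] X} (h : IsDrazinInvertible S) :
    IsBFredholm S := by
  obtain ⟨m, b, hb, hm⟩ := h
  have hSb : Commute S b := (hb S (.refl S)).symm
  have hkey := pow_eq_pow_add_mul_pow hm m
  have hmem (x : X) : x ∈ (S ^ m).range ↔ (S ^ m * b ^ m) x = x := by
    constructor
    · rintro ⟨y, rfl⟩
      refine DFunLike.congr_fun (?_ : S ^ m * b ^ m * S ^ m = S ^ m) y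
      rw [mul_assoc, ← (hSb.pow_pow m m).eq, ← mul_assoc, ← pow_add, ← hkey]
    · intro hx
      rw [← hx]
      exact ⟨(b ^ m) x, rfl⟩
  refine ⟨m, ?_, ?_⟩
  · have : ((S ^ m).range : Set X) = {x | (S ^ m * b ^ m) x = x} := Set.ext hmem
    rw [this]
    exact isClosed_eq (S ^ m * b ^ m).continuous continuous_id
  · have hbp := mem_range_pow_of_commute hSb m
    have h1 (x : X) (hx : x ∈ (S ^ m).range) : S (b x) = x := by
      obtain ⟨y, rfl⟩ := hx
      refine DFunLike.congr_fun (?_ : S * (b * S ^ m) = S ^ m) y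
      rw [← (hSb.pow_left m).eq, ← mul_assoc, ← pow_succ', ← hm]
    have h2 (x : X) (hx : x ∈ (S ^ m).range) : b (S x) = x :=
      (DFunLike.congr_fun hSb.eq x).symm.trans (h1 x hx)
    let e : (S ^ m).range ≃ₗ[ℂ] (S ^ m).range :=
      { (restrictRangePow S m : (S ^ m).range →ₗ[ℂ] (S ^ m).range) with
        invFun := b.restrict hbp
        left_inv := fun x => Subtype.ext (h2 x x.2)
        right_inv := fun x => Subtype.ext (h1 x x.2) }
    exact ContinuousLinearMap.IsFredholm.of_isQuasiInverse (v := b.restrict hbp)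
      e.isQuasiInverse

variable [CompleteSpace X]

/-- The ranges of S^(m+k) are closed; let `D` be their intersection. The finite-dimensional spaces
ker S ∩ R(S^(m+k)) decrease, hence are constant from some k₀ on, which makes S map `D` onto `D`.
Being a limit of invertibles there, S is injective on `D`. The stable kernel lies in `D`, so it is
zero: S is injective with closed range on R(S^(m+k₀)), and the limit argument makes it invertible
there. -/
theorem IsBFredholm.isDrazinInvertible {S : X →L[ℂ] X} (hS : IsBFredholm S)
    (hf : ∃ᶠ z in 𝓝[≠] 0, IsUnit (S - algebraMap ℂ (X →L[ℂ] X) z)) : IsDrazinInvertible S := by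
  obtain ⟨m, hcl, hF⟩ := hS
  have hclosed (k : ℕ) : IsClosed ((S ^ (m + k)).range : Set X) := by
    have : CompleteSpace (S ^ m).range := hcl.completeSpace_coe
    have h1 := (hF.pow k).isClosed_range
    have h2 := (hcl.isClosedEmbedding_subtypeVal).isClosedMap _ h1
    convert h2 using 1
    ext x
    constructor
    · rintro ⟨y, rfl⟩
      refine ⟨(restrictRangePow S m ^ k) ⟨(S ^ m) y, y, rfl⟩, ⟨_, rfl⟩, ?_⟩
      rw [coe_restrictRangePow_pow_apply, add_comm, pow_add]
      rfl
    · rintro ⟨_, ⟨⟨_, y, rfl⟩, rfl⟩, rfl⟩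
      refine ⟨y, ?_⟩
      show _ = ((restrictRangePow S m ^ k) _ : X)
      rw [coe_restrictRangePow_pow_apply, add_comm, pow_add]
      rfl
  let N (k : ℕ) : Submodule ℂ X := S.ker ⊓ (S ^ (m + k)).range
  have hNanti : Antitone N := fun i j hij =>
    inf_le_inf_left _ (range_pow_antitone S (by omega))
  have hN0 : FiniteDimensional ℂ (N 0) := by
    have := hF.finite_ker
    have hle : N 0 ≤ (restrictRangePow S m).ker.map (S ^ m).range.subtype := by
      rintro x ⟨hx, hx'⟩
      exact ⟨⟨x, hx'⟩, Subtype.ext hx, rfl⟩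
    exact Submodule.finiteDimensional_of_le hle
  have hNfin (k : ℕ) : FiniteDimensional ℂ (N k) :=
    Submodule.finiteDimensional_of_le (hNanti (Nat.zero_le k))
  obtain ⟨k₀, hk₀⟩ : ∃ k₀, ∀ k, Module.finrank ℂ (N k₀) ≤ Module.finrank ℂ (N k) :=
    ⟨_, fun k => Function.argmin_le (fun k => Module.finrank ℂ (N k)) k⟩
  have hstab (k : ℕ) : N k₀ ≤ N k := by
    rcases le_total k k₀ with h | h
    · exact hNanti h
    · exact (Submodule.eq_of_le_of_finrank_le (hNanti h) (hk₀ k)).ge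
  let D : Submodule ℂ X := ⨅ k, (S ^ (m + k)).range
  have hDmem (x : X) : x ∈ D ↔ ∀ k, x ∈ (S ^ (m + k)).range := Submodule.mem_iInf _
  have hDcl : IsClosed (D : Set X) := by
    simp only [D, Submodule.coe_iInf]
    exact isClosed_iInter hclosed
  have hDG : ∀ G : X →L[ℂ] X, Commute S G → ∀ x ∈ D, G x ∈ D := fun G hG x hx =>
    (hDmem _).2 fun k => mem_range_pow_of_commute hG _ _ ((hDmem x).1 hx k)
  have hDS := hDG S (.refl S)
  have hsurj : Function.Surjective (S.restrict hDS) := by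
    rintro ⟨y, hy⟩
    have hpre (k : ℕ) : ∃ x ∈ (S ^ (m + k)).range, S x = y := by
      obtain ⟨w, hw⟩ := (hDmem y).1 hy (k + 1)
      refine ⟨(S ^ (m + k)) w, ⟨w, rfl⟩, ?_⟩
      rw [← hw, ← add_assoc, pow_succ']
      rfl
    obtain ⟨x, hx, hxy⟩ := hpre k₀
    refine ⟨⟨x, (hDmem x).2 fun k => ?_⟩, Subtype.ext hxy⟩
    -- Two preimages of y differ by an element of `N k₀`, which lies in every range; so x lies in
    -- each range along with x'.
    obtain ⟨x', hx', hxy'⟩ := hpre (max k k₀)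
    have hd : x - x' ∈ N k₀ := by
      refine ⟨?_, Submodule.sub_mem _ hx (range_pow_antitone S (by omega) hx')⟩
      show S (x - x') = 0
      rw [map_sub, hxy, hxy', sub_self]
    have h1 := (hstab k hd).2
    have h2 : x' ∈ (S ^ (m + k)).range := range_pow_antitone S (by omega) hx'
    simpa using Submodule.add_mem _ h1 h2
  have hinj : Function.Injective (S.restrict hDS) := by
    have : CompleteSpace D := hDcl.completeSpace_coe
    exact injective_of_surjective_of_frequently_isUnit hsurj
      (hf.mono fun z hz => isUnit_restrict_sub hDS hDG hz)
  have hinj' : Function.Injective (restrictRangePow S (m + k₀)) := by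
    rw [injective_iff_map_eq_zero]
    rintro ⟨x, hx⟩ hSx
    have hSx' : S x = 0 := congrArg Subtype.val hSx
    have hxN : x ∈ N k₀ := ⟨hSx', hx⟩
    have hxD : x ∈ D := (hDmem x).2 fun k => (hstab k hxN).2
    have := (injective_iff_map_eq_zero (S.restrict hDS)).1 hinj ⟨x, hxD⟩ (Subtype.ext hSx')
    exact Subtype.ext (congrArg (fun v : D => (v : X)) this)
  have : CompleteSpace (S ^ (m + k₀)).range := (hclosed k₀).completeSpace_coe
  have hrange : IsClosed (Set.range (restrictRangePow S (m + k₀))) := by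
    have : Set.range (restrictRangePow S (m + k₀)) =
        Subtype.val ⁻¹' ((S ^ (m + (k₀ + 1))).range : Set X) := by
      ext x
      constructor
      · rintro ⟨⟨_, y, rfl⟩, rfl⟩
        refine ⟨y, ?_⟩
        rw [← add_assoc, pow_succ']
        rfl
      · rintro ⟨y, hy⟩
        refine ⟨⟨(S ^ (m + k₀)) y, y, rfl⟩, Subtype.ext ?_⟩
        rw [← hy, ← add_assoc, pow_succ']
        rfl
    rw [this]
    exact (hclosed (k₀ + 1)).preimage continuous_subtype_val
  obtain ⟨K, hK⟩ := (restrictRangePow S (m + k₀)).antilipschitz_of_injective_of_isClosed_range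
    hinj' hrange
  refine IsDrazinInvertible.of_isUnit_restrictRangePow
    (isUnit_of_antilipschitz_of_frequently_isUnit hK (hf.mono fun z hz => ?_))
  exact isUnit_restrict_sub _ (fun G hG => mem_range_pow_of_commute hG _) hz

/-- Finiteness makes every z a limit of resolvent points: otherwise a punctured neighbourhood of z
lies in the spectrum, yet contains Drazin points, which are never accumulation points of the
spectrum. -/
theorem bFredholmSpectrum_eq_drazinSpectrum {T : X →L[ℂ] X} (h : (drazinSpectrum T).Finite) :
    bFredholmSpectrum T = drazinSpectrum T := by
  refine Set.Subset.antisymm (fun z hz hd => hz hd.isBFredholm) fun z hz hB => hz ?_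
  refine hB.isDrazinInvertible ?_
  by_contra hnf
  rw [not_frequently] at hnf
  have hadd : Tendsto (fun w : ℂ => w - z) (𝓝[≠] z) (𝓝[≠] 0) := tendsto_sub_nhdsNE z
  have h1 : ∀ᶠ w in 𝓝[≠] z, w ∈ spectrum ℂ T := by
    filter_upwards [hadd.eventually hnf] with w hw
    rw [spectrum.mem_iff]
    intro hu
    refine hw ?_
    have : T - algebraMap ℂ (X →L[ℂ] X) z - algebraMap ℂ (X →L[ℂ] X) (w - z) =
        -(algebraMap ℂ (X →L[ℂ] X) w - T) := by
      rw [map_sub]; abel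
    rw [this]
    exact hu.neg
  have h2 : ∀ᶠ w in 𝓝[≠] z, w ∉ drazinSpectrum T := by
    have h3 : (drazinSpectrum T \ {z})ᶜ ∈ 𝓝 z :=
      (h.subset Set.sdiff_subset).isClosed.isOpen_compl.mem_nhds (by simp)
    filter_upwards [nhdsWithin_le_nhds h3, self_mem_nhdsWithin] with w hw hne hd
    exact hw ⟨hd, hne⟩
  obtain ⟨w, hw1, hw2⟩ := ((eventually_nhdsNE_eventually_nhds_iff.2 h1).and h2).exists
  refine (not_not.1 hw2 : IsDrazinInvertible _).not_accPt ?_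
  rw [accPt_iff_frequently_nhdsNE]
  exact Filter.Eventually.frequently (Filter.Eventually.filter_mono nhdsWithin_le_nhds hw1)

end BFredholm

/-! ### Compression to the range of an idempotent. -/

section Corners

variable {X : Type*} [NormedAddCommGroup X] [NormedSpace ℂ X]

/-- The compression of the operator `x` to the range of `p`. -/
def corner (p x : X →L[ℂ] X) : p.range →L[ℂ] p.range :=
  ((p * x).codRestrict p.range fun v => ⟨x v, rfl⟩) ∘L p.range.subtypeL

variable {p x y : X →L[ℂ] X}

theorem coe_corner_apply (p x : X →L[ℂ] X) (v : p.range) : (corner p x v : X) = p (x v) := rfl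

theorem IsIdempotentElem.apply_of_mem_range (hp : IsIdempotentElem p) {v : X}
    (hv : v ∈ p.range) : p v = v := by
  obtain ⟨w, rfl⟩ := hv
  exact DFunLike.congr_fun hp.eq w

theorem IsIdempotentElem.isClosed_coe_range (hp : IsIdempotentElem p) :
    IsClosed (p.range : Set X) := by
  have : (p.range : Set X) = {v | p v = v} :=
    Set.ext fun v => ⟨hp.apply_of_mem_range, fun h => ⟨v, h⟩⟩
  rw [this]
  exact isClosed_eq p.continuous continuous_id

theorem coe_corner_apply_of_commute (hp : IsIdempotentElem p) (hx : Commute p x) (v : p.range) :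
    (corner p x v : X) = x v := by
  rw [coe_corner_apply]
  refine (DFunLike.congr_fun hx.eq (v : X)).trans ?_
  rw [mul_apply_eq_comp, hp.apply_of_mem_range v.2]

theorem corner_mul (hp : IsIdempotentElem p) (hx : Commute p x) :
    corner p (x * y) = corner p x * corner p y := by
  ext v
  rw [mul_apply_eq_comp, coe_corner_apply, coe_corner_apply, coe_corner_apply]
  refine DFunLike.congr_fun (?_ : p * (x * y) = p * (x * (p * y))) (v : X)
  rw [← mul_assoc x, ← hx.eq, mul_assoc p, ← mul_assoc p p, hp.eq]

theorem corner_self (hp : IsIdempotentElem p) : corner p p = 1 := by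
  ext v
  rw [coe_corner_apply, hp.apply_of_mem_range v.2, hp.apply_of_mem_range v.2]
  rfl

theorem corner_one (hp : IsIdempotentElem p) : corner p 1 = 1 := by
  ext v
  exact hp.apply_of_mem_range v.2

theorem corner_sub_algebraMap (hp : IsIdempotentElem p) (x : X →L[ℂ] X) (z : ℂ) :
    corner p (x - algebraMap ℂ (X →L[ℂ] X) z) =
      corner p x - algebraMap ℂ (p.range →L[ℂ] p.range) z := by
  ext v
  rw [coe_corner_apply, sub_algebraMap_apply, sub_algebraMap_apply, map_sub, map_smul,
    hp.apply_of_mem_range v.2]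
  rfl

theorem corner_pow (hp : IsIdempotentElem p) (hx : Commute p x) (n : ℕ) :
    corner p (x ^ n) = corner p x ^ n := by
  induction n with
  | zero => exact corner_one hp
  | succ n ih => rw [pow_succ', pow_succ', corner_mul hp hx, ih]

theorem isDrazinInvertible_corner (hp : IsIdempotentElem p) (hx : Commute p x)
    (hpy : Commute p y) (hxy : Commute x y) {m : ℕ} (h : x ^ m * p = x ^ (m + 1) * y * p) :
    IsDrazinInvertible (corner p x) := by
  refine IsDrazinInvertible.of_commute (b := corner p y) (m := m) ?_ ?_
  · show _ * _ = _ * _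
    rw [← corner_mul hp hx, ← corner_mul hp hpy, hxy.eq]
  · have := congrArg (corner p) h
    rwa [corner_mul hp (hx.pow_right m), corner_mul hp ((hx.pow_right _).mul_right hpy),
      corner_mul hp (hx.pow_right _), corner_self hp, mul_one, mul_one, corner_pow hp hx,
      corner_pow hp hx] at this

variable [CompleteSpace X]

/-- A nonzero idempotent carries some part of the spectrum. -/
theorem IsIdempotentElem.eq_zero_of_forall_sub_mul_eq (hp : IsIdempotentElem p)
    (hx : Commute p x)
    (h : ∀ z, ∃ c, Commute p c ∧ Commute x c ∧ (x - algebraMap ℂ (X →L[ℂ] X) z) * c = p) :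
    p = 0 := by
  by_contra hp0
  have : CompleteSpace p.range := hp.isClosed_coe_range.completeSpace_coe
  have : Nontrivial p.range := by
    rw [Submodule.nontrivial_iff_ne_bot]
    intro hbot
    refine hp0 (ContinuousLinearMap.ext fun v => ?_)
    exact (Submodule.mem_bot ℂ).1 (hbot ▸ ⟨v, rfl⟩ : p v ∈ (⊥ : Submodule ℂ X))
  -- On a nonzero Banach space the spectrum is nonempty, but the compressions of the elements c
  -- invert `corner p x` minus every scalar.
  obtain ⟨z, hz⟩ := spectrum.nonempty (corner p x)
  obtain ⟨c, hpc, hxc, hc⟩ := h z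
  have hxz : Commute p (x - algebraMap ℂ (X →L[ℂ] X) z) :=
    hx.sub_right (Algebra.commutes z p).symm
  have hcz : Commute c (x - algebraMap ℂ (X →L[ℂ] X) z) :=
    hxc.symm.sub_right (Algebra.commutes z c).symm
  refine hz ?_
  have h1 : (corner p x - algebraMap ℂ (p.range →L[ℂ] p.range) z) * corner p c = 1 := by
    rw [← corner_sub_algebraMap hp, ← corner_mul hp hxz, hc, corner_self hp]
  have h2 : corner p c * (corner p x - algebraMap ℂ (p.range →L[ℂ] p.range) z) = 1 := by
    rw [← corner_sub_algebraMap hp, ← corner_mul hp hpc, hcz.eq, hc, corner_self hp]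
  rw [spectrum.mem_resolventSet_iff, ← neg_sub]
  exact (isUnit_iff_exists.2 ⟨_, h1, h2⟩).neg

end Corners

/-! ### The decomposition for a finite Drazin spectrum. -/

section SpectralDecomposition

/-- Drazin points are not accumulation points of the spectrum, so a compact annulus around d
contains finitely many spectral points and only finitely many radii are excluded. -/
theorem exists_sphere_subset_resolventSet {A : Type*} [NormedRing A] [NormedAlgebra ℂ A]
    [CompleteSpace A] {T : A} {d : ℂ} {ε : ℝ} (hε : 0 < ε)
    (h : ∀ z ∈ Metric.ball d ε, z ≠ d → IsDrazinInvertible (T - algebraMap ℂ A z)) :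
    ∃ r, 0 < r ∧ r < ε ∧ Metric.sphere d r ⊆ resolventSet ℂ T := by
  set K : Set ℂ := Metric.closedBall d (ε / 2) \ Metric.ball d (ε / 4)
  have hKc : IsCompact K := (isCompact_closedBall d _).diff Metric.isOpen_ball
  have hfin : (K ∩ spectrum ℂ T).Finite := by
    by_contra hinf
    obtain ⟨z, hz, hacc⟩ := Set.Infinite.exists_accPt_of_subset_isCompact hinf hKc
      Set.inter_subset_left
    refine (h z ?_ ?_).not_accPt (hacc.mono (principal_mono.2 Set.inter_subset_right))
    · exact Metric.closedBall_subset_ball (by linarith) hz.1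
    · rintro rfl
      exact hz.2 (Metric.mem_ball_self (by linarith))
  obtain ⟨r, hr, hr'⟩ := ((Set.Ioo_infinite (show ε / 4 < ε / 2 by linarith)).sdiff
    (hfin.image fun z => dist z d)).nonempty
  refine ⟨r, by linarith [hr.1], by linarith [hr.2], fun z hz => ?_⟩
  by_contra hzs
  refine hr' ⟨z, ⟨⟨?_, ?_⟩, hzs⟩, hz⟩
  · rw [Metric.mem_closedBall, Metric.mem_sphere.1 hz]; exact hr.2.le
  · rw [Metric.mem_ball, Metric.mem_sphere.1 hz]; exact not_lt.2 hr.1.le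

variable {X : Type*} [NormedAddCommGroup X] [NormedSpace ℂ X] [CompleteSpace X]

/-- `x` is Drazin invertible on the range of `p`, with an inverse in the double commutant of `T`. -/
def IsDrazinInvertibleOn {R : Type*} [Ring R] (T x p : R) : Prop :=
  ∃ (m : ℕ) (b : R), (∀ c, Commute T c → Commute b c) ∧ x ^ m * p = x ^ (m + 1) * b * p

theorem IsDrazinInvertible.isDrazinInvertibleOn {A : Type*} [Ring A] [Algebra ℂ A] {T : A} {z : ℂ}
    (h : IsDrazinInvertible (T - algebraMap ℂ A z)) (p : A) :
    IsDrazinInvertibleOn T (T - algebraMap ℂ A z) p := by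
  obtain ⟨m, b, hb, hm⟩ := h
  exact ⟨m, b, fun c hc => hb c (hc.sub_left (Algebra.commutes _ _)), by rw [← hm]⟩

theorem exists_spectral_decomposition {T : X →L[ℂ] X} (hfin : (drazinSpectrum T).Finite) :
    ∃ (n : ℕ) (p : Fin n → X →L[ℂ] X) (c : Fin n → ℂ), 0 < n ∧ CompleteOrthogonalIdempotents p ∧
      (∀ i x, Commute T x → Commute (p i) x) ∧
      (∀ i z, z ≠ c i → IsDrazinInvertibleOn T (T - algebraMap ℂ (X →L[ℂ] X) z) (p i)) ∧
      ((drazinSpectrum T).Nonempty → ∀ i, c i ∈ drazinSpectrum T) ∧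
      ∀ d ∈ drazinSpectrum T, ∃ i, c i = d ∧ p i ≠ 0 := by
  classical
  have hε (d : drazinSpectrum T) : ∃ ε > 0, ∀ z ∈ Metric.ball (d : ℂ) ε, z ≠ d →
      IsDrazinInvertible (T - algebraMap ℂ (X →L[ℂ] X) z) := by
    have h3 : (drazinSpectrum T \ {(d : ℂ)})ᶜ ∈ 𝓝 (d : ℂ) :=
      (hfin.subset Set.sdiff_subset).isClosed.isOpen_compl.mem_nhds (by simp)
    obtain ⟨ε, hε, hsub⟩ := Metric.mem_nhds_iff.1 h3
    exact ⟨ε, hε, fun z hz hne => by_contra fun hd => hsub hz ⟨hd, hne⟩⟩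
  choose ε hε0 hεd using hε
  -- Since ε d is at most the distance from d to the other points, radii below ε d / 2 give disjoint
  -- closed discs.
  have hr (d : drazinSpectrum T) := exists_sphere_subset_resolventSet (T := T) (d := d)
    (half_pos (hε0 d)) fun z hz => hεd d z (Metric.ball_subset_ball (half_le_self (hε0 d).le) hz)
  choose r hr0 hrε hsph using hr
  have hriesz (d : drazinSpectrum T) := exists_riesz_idempotent (hr0 d) (hsph d)
  choose e hidem hcomm hout hin using hriesz
  have hTe (d) : Commute (e d) T := hcomm d T (.refl T)
  have hortho : Pairwise fun d d' => e d * e d' = 0 := by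
    intro d d' hdd'
    have hee : Commute (e d) (e d') := hcomm d _ (hTe d').symm
    -- Every z lies outside one of the two discs, so T - z is invertible on the range of the
    -- idempotent e d * e d', which must vanish.
    refine (((hidem d).mul_of_commute hee (hidem d'))).eq_zero_of_forall_sub_mul_eq (x := T)
      ((hTe d).mul_left (hTe d')) fun z => ?_
    have hdist : r d + r d' < dist (d : ℂ) d' := by
      have hne : (d : ℂ) ≠ d' := fun h => hdd' (Subtype.ext h)
      have h1 : ε d ≤ dist (d : ℂ) d' := not_lt.1 fun h => d'.2 (hεd d d' (by
        rwa [Metric.mem_ball, dist_comm]) hne.symm)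
      have h2 : ε d' ≤ dist (d : ℂ) d' := not_lt.1 fun h => d.2 (hεd d' d h hne)
      linarith [hrε d, hrε d']
    by_cases hz : z ∈ Metric.closedBall (d : ℂ) (r d)
    · have hz' : z ∉ Metric.closedBall (d' : ℂ) (r d') := fun hz' => by
        rw [Metric.mem_closedBall] at hz hz'
        linarith [dist_triangle_left (d : ℂ) d' z]
      obtain ⟨c, hc, hce⟩ := hout d' z hz'
      refine ⟨c * e d, ?_, ?_, ?_⟩
      · refine Commute.mul_left ?_ ?_
        · exact ((hc _ (hTe d).symm).symm).mul_right (.refl _)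
        · exact ((hc _ (hTe d').symm).symm).mul_right hee.symm
      · exact ((hc T (.refl T)).symm).mul_right (hTe d).symm
      · rw [← mul_assoc, hce, hee.eq]
    · obtain ⟨c, hc, hce⟩ := hout d z hz
      refine ⟨c * e d', ?_, ?_, ?_⟩
      · refine Commute.mul_left ?_ ?_
        · exact ((hc _ (hTe d).symm).symm).mul_right hee
        · exact ((hc _ (hTe d').symm).symm).mul_right (.refl _)
      · exact ((hc T (.refl T)).symm).mul_right (hTe d').symm
      · rw [← mul_assoc, hce]
  have := hfin.fintype
  have hcompl := CompleteOrthogonalIdempotents.option (e := e) ⟨hidem, hortho⟩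
  let p : Option (drazinSpectrum T) → X →L[ℂ] X := (Option.elim · (1 - ∑ d, e d) e)
  -- The scalar of the complementary summand is arbitrary; taking it in the Drazin spectrum keeps
  -- the spectrum of U from growing.
  obtain ⟨c₀, hc₀⟩ : ∃ c₀, (drazinSpectrum T).Nonempty → c₀ ∈ drazinSpectrum T := by
    by_cases h : (drazinSpectrum T).Nonempty
    · exact ⟨h.some, fun _ => h.some_mem⟩
    · exact ⟨0, fun h' => (h h').elim⟩
  let c : Option (drazinSpectrum T) → ℂ := (Option.elim · c₀ Subtype.val)
  let σ := (Fintype.equivFin (Option (drazinSpectrum T))).symm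
  refine ⟨_, p ∘ σ, c ∘ σ, Fintype.card_pos, (CompleteOrthogonalIdempotents.equiv σ).2 hcompl,
    fun i x hx => ?_, fun i z hz => ?_, fun h i => ?_, fun d hd => ⟨σ.symm (some ⟨d, hd⟩), ?_⟩⟩
  · show Commute (p (σ i)) x
    rcases σ i with _ | d
    · exact (Commute.one_left x).sub_left (Commute.sum_left _ _ _ fun d _ => hcomm d x hx)
    · exact hcomm d x hx
  · change z ≠ c (σ i) at hz
    show IsDrazinInvertibleOn _ _ (p (σ i))
    generalize σ i = o at hz
    by_cases hzd : IsDrazinInvertible (T - algebraMap ℂ (X →L[ℂ] X) z)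
    · exact hzd.isDrazinInvertibleOn _
    rcases o with _ | d
    -- Here z is a point of the Drazin spectrum, and T - z is invertible on the range of 1 - e z,
    -- which contains that of the complementary projection.
    · obtain ⟨b, hb, hbe⟩ := hin ⟨z, hzd⟩ z (Metric.mem_ball_self (hr0 _))
      refine ⟨0, b, hb, ?_⟩
      have h1 : e ⟨z, hzd⟩ * p none = 0 :=
        hcompl.ortho (i := some ⟨z, hzd⟩) (j := none) (by simp)
      rw [zero_add, pow_one, hbe, sub_mul, h1, pow_zero, sub_zero]
    · have hout' : z ∉ Metric.closedBall (d : ℂ) (r d) := fun h =>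
        hzd (hεd d z (Metric.closedBall_subset_ball (by linarith [hrε d, hε0 d]) h) hz)
      obtain ⟨b, hb, hbe⟩ := hout d z hout'
      exact ⟨0, b, hb, by rw [zero_add, pow_one, hbe, pow_zero, one_mul]; exact (hidem d).eq.symm⟩
  · show c (σ i) ∈ _
    rcases σ i with _ | d
    · exact hc₀ h
    · exact d.2
  · simp only [Function.comp_apply, Equiv.apply_symm_apply]
    -- If e d were zero, T - d would be invertible.
    refine ⟨rfl, fun h0 => hd ?_⟩
    have h0 : e ⟨d, hd⟩ = 0 := h0
    obtain ⟨b, hb, hbe⟩ := hin ⟨d, hd⟩ d (Metric.mem_ball_self (hr0 _))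
    rw [h0, sub_zero] at hbe
    refine IsUnit.isDrazinInvertible (isUnit_iff_exists.2 ⟨b, hbe, ?_⟩)
    rw [← hbe]
    exact ((hb T (.refl T)).sub_right (Algebra.commutes _ _).symm).eq

end SpectralDecomposition

/-! ### Assembling the summands. -/

section MainTheorem

theorem sum_smul_mul_of_orthogonal {ι A : Type*} [Fintype ι] [Ring A] [Algebra ℂ A] {p : ι → A}
    (hp : OrthogonalIdempotents p) (c : ι → ℂ) (i : ι) : (∑ j, c j • p j) * p i = c i • p i := by
  classical
  rw [Finset.sum_mul, Finset.sum_eq_single i]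
  · rw [smul_mul_assoc, (hp.idem i).eq]
  · intro j _ hj
    rw [smul_mul_assoc, hp.ortho hj, smul_zero]
  · simp

theorem commute_sum_smul {ι A : Type*} [Fintype ι] [Ring A] [Algebra ℂ A] {p : ι → A} {x : A}
    (hp : ∀ i, Commute x (p i)) (c : ι → ℂ) : Commute x (∑ j, c j • p j) :=
  Commute.sum_right _ _ _ fun j _ => (hp j).smul_right (c j)

/-- Drazin invertibility is checked on the summands of a decomposition of the identity. -/
theorem isDrazinInvertible_of_forall_mul_eq {ι A : Type*} [Fintype ι] [Ring A] {p : ι → A}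
    (hp : CompleteOrthogonalIdempotents p) {T x : A} (hpT : ∀ i y, Commute T y → Commute (p i) y)
    (hxT : ∀ y, Commute T y → (∀ i, Commute (p i) y) → Commute x y) {y : ι → A}
    (hTy : ∀ i, Commute T (y i)) (hxy : ∀ i, x * p i = y i * p i)
    (hy : ∀ i, IsDrazinInvertibleOn T (y i) (p i)) : IsDrazinInvertible x := by
  choose m b hb hm using hy
  have hpTT (i) : Commute (p i) T := hpT i T (.refl T)
  have hxp (i) : Commute x (p i) := hxT _ (hpTT i).symm fun j => hpT j _ (hpTT i).symm
  have hyp (i) : Commute (y i) (p i) := (hpT i _ (hTy i)).symm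
  have hxb (i) : Commute x (b i) :=
    hxT _ (hb i T (.refl T)).symm fun j => hpT j _ (hb i T (.refl T)).symm
  have hbp (i) : Commute (b i) (p i) := hb i _ (hpTT i).symm
  have hpow (i n) : x ^ n * p i = y i ^ n * p i := by
    induction n with
    | zero => rw [pow_zero, pow_zero]
    | succ n ih =>
      rw [pow_succ, mul_assoc, hxy, ← (hyp i).symm.eq, ← mul_assoc, ih, mul_assoc, (hyp i).symm.eq,
        ← mul_assoc, ← pow_succ]
  have hle (i) : m i ≤ ∑ j, m j := Finset.single_le_sum (fun _ _ => Nat.zero_le _)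
    (Finset.mem_univ i)
  -- The sum of the exponents is merely a common upper bound for them.
  refine IsDrazinInvertible.of_commute (b := ∑ i, b i * p i) (m := ∑ j, m j)
    (Commute.sum_right _ _ _ fun i _ => (hxb i).mul_right (hxp i)) ?_
  rw [Finset.mul_sum, ← mul_one (x ^ _), ← hp.complete, Finset.mul_sum]
  refine Finset.sum_congr rfl fun i _ => ?_
  obtain ⟨k, hk⟩ := Nat.exists_eq_add_of_le' (hle i)
  rw [hpow, (hbp i).eq, ← mul_assoc, hpow, mul_assoc, ← (hbp i).eq, ← mul_assoc, hk, pow_add,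
    mul_assoc, hm, ← mul_assoc, ← mul_assoc, ← pow_add]
  rfl

variable {X : Type*} [NormedAddCommGroup X] [NormedSpace ℂ X]

theorem isInternal_range_of_completeOrthogonalIdempotents {ι : Type*} [Fintype ι] [DecidableEq ι]
    {p : ι → X →L[ℂ] X} (hp : CompleteOrthogonalIdempotents p) :
    DirectSum.IsInternal fun i => (p i).range := by
  rw [DirectSum.isInternal_submodule_iff_iSupIndep_and_iSup_eq_top]
  constructor
  · intro i
    have hker : ⨆ j, ⨆ _ : j ≠ i, (p j).range ≤ (p i).ker := by
      refine iSup₂_le fun j hj => ?_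
      rintro _ ⟨y, rfl⟩
      exact DFunLike.congr_fun (hp.ortho hj.symm) y
    rw [Submodule.disjoint_def]
    intro x hx hx'
    rw [← (hp.idem i).apply_of_mem_range hx]
    exact hker hx'
  · rw [eq_top_iff]
    intro x _
    have hx : x = ∑ i, p i x := by
      have := DFunLike.congr_fun hp.complete x
      rw [sum_apply] at this
      exact this.symm
    rw [hx]
    exact Submodule.sum_mem _ fun i _ => Submodule.mem_iSup_of_mem i ⟨x, rfl⟩

/-- Off these points the inverse is the sum of the (z - c i)⁻¹ • p i. Scalars with p i = 0
contribute nothing and must be left out. -/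
theorem spectrum_sum_smul {ι A : Type*} [Fintype ι] [Ring A] [Algebra ℂ A] {p : ι → A}
    (hp : CompleteOrthogonalIdempotents p) (c : ι → ℂ) :
    spectrum ℂ (∑ i, c i • p i) = {z | ∃ i, c i = z ∧ p i ≠ 0} := by
  have hmul (z : ℂ) (i) : (algebraMap ℂ A z - ∑ i, c i • p i) * p i = (z - c i) • p i := by
    rw [sub_mul, sum_smul_mul_of_orthogonal hp.1, ← Algebra.smul_def, sub_smul]
  ext z
  constructor
  · intro hz
    by_contra hne
    refine hz ?_
    have h0 (i) : (z - c i) • (z - c i)⁻¹ • p i = p i := by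
      by_cases hpi : p i = 0
      · simp [hpi]
      · rw [smul_smul, mul_inv_cancel₀, one_smul]
        rw [sub_ne_zero]
        exact fun h => hne ⟨i, h.symm, hpi⟩
    have h1 : (algebraMap ℂ A z - ∑ i, c i • p i) * ∑ i, (z - c i)⁻¹ • p i = 1 := by
      rw [Finset.mul_sum, ← hp.complete]
      refine Finset.sum_congr rfl fun i _ => ?_
      rw [mul_smul_comm, hmul, smul_comm, h0]
    have hpc (i j) : Commute (p i) (p j) := by
      by_cases hij : i = j
      · rw [hij]
      · show _ = _
        rw [hp.ortho hij, hp.ortho (Ne.symm hij)]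
    have hcomm : Commute (algebraMap ℂ A z - ∑ i, c i • p i) (∑ i, (z - c i)⁻¹ • p i) :=
      Commute.sub_left (Algebra.commutes _ _)
        (commute_sum_smul (fun i => (commute_sum_smul (hpc i) c).symm) _)
    exact spectrum.mem_resolventSet_of_left_right_inverse h1 (hcomm.eq ▸ h1)
  · rintro ⟨i, rfl, hi⟩ hu
    refine hi ((IsUnit.mul_right_eq_zero hu).1 ?_)
    rw [hmul, sub_self, zero_smul]

end MainTheorem

theorem mainTheorem1 {X : Type*} [NormedAddCommGroup X] [NormedSpace ℂ X] [CompleteSpace X]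
    (T : X →L[ℂ] X) (hT : HasGeneralizedMeromorphicResolvent T) :
    IsPolynomiallyMeromorphic T ∧
    ∃ (n : ℕ) (V : Fin n → Submodule ℂ X) (c : Fin n → ℂ) (M Q : ∀ i, V i →L[ℂ] V i),
      0 < n ∧
      (∀ i, IsClosed (V i : Set X)) ∧
      DirectSum.IsInternal V ∧
      (∀ i, IsMeromorphicOperator (M i)) ∧
      (∀ i, IsQuasinilpotentOperator (Q i)) ∧
      (∀ i, IsQuasinilpotentOperator (M i * Q i - Q i * M i)) ∧
      IsDirectSumOfOperators V
        (fun i => M i + Q i + c i • ContinuousLinearMap.id ℂ (V i)) T ∧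
      ∃ M' Q' U : X →L[ℂ] X,
        T = M' + Q' + U ∧
        IsDirectSumOfOperators V M M' ∧
        IsDirectSumOfOperators V Q Q' ∧
        IsDirectSumOfOperators V (fun i => c i • ContinuousLinearMap.id ℂ (V i)) U ∧
        IsMeromorphicOperator M' ∧
        IsQuasinilpotentOperator Q' ∧
        IsQuasinilpotentOperator (M' * Q' - Q' * M') ∧
        ((bFredholmSpectrum T).Nonempty → spectrum ℂ U = bFredholmSpectrum T) := by

  have hfin := isPolynomiallyMeromorphic_iff.1 hT.isPolynomiallyMeromorphic
  refine ⟨hT.isPolynomiallyMeromorphic, ?_⟩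
  obtain ⟨n, p, c, hn, hp, hcomm, hD, hcσ, hσc⟩ := exists_spectral_decomposition hfin
  have hpT (i) : Commute (p i) T := hcomm i T (.refl T)
  have hsub (i) (z : ℂ) : Commute (p i) (T - algebraMap ℂ (X →L[ℂ] X) z) :=
    (hpT i).sub_right (Algebra.commutes z (p i)).symm
  set U : X →L[ℂ] X := ∑ i, c i • p i with hU
  have hUV (i) (x : (p i).range) : U x = c i • (x : X) := by
    have h1 := DFunLike.congr_fun (sum_smul_mul_of_orthogonal hp.1 c i) (x : X)
    rw [mul_apply_eq_comp, (hp.idem i).apply_of_mem_range x.2, smul_apply,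
      (hp.idem i).apply_of_mem_range x.2] at h1
    exact h1
  have hcl (i) : IsClosed ((p i).range : Set X) := (hp.idem i).isClosed_coe_range
  have hcorner (i) (x : (p i).range) :
      (corner (p i) (T - algebraMap ℂ (X →L[ℂ] X) (c i)) x : X) = T x - c i • (x : X) := by
    rw [coe_corner_apply_of_commute (hp.idem i) (hsub i _), sub_algebraMap_apply]
  have hshift (w z : ℂ) : T - algebraMap ℂ (X →L[ℂ] X) w - algebraMap ℂ (X →L[ℂ] X) z =
      T - algebraMap ℂ (X →L[ℂ] X) (w + z) := by
    rw [map_add]; abel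
  have hzero {Y : Type _} [NormedAddCommGroup Y] [NormedSpace ℂ Y] :
      IsQuasinilpotentOperator (0 : Y →L[ℂ] Y) := spectrum.spectralRadius_zero
  -- All Q i are zero: T - c i is already meromorphic on the range of p i.
  refine ⟨n, fun i => (p i).range, c, fun i => corner (p i) (T - algebraMap ℂ (X →L[ℂ] X) (c i)),
    fun _ => 0, hn, hcl, isInternal_range_of_completeOrthogonalIdempotents hp, fun i => ?_,
    fun i => hzero, fun i => ?_, fun i x => ?_, T - U, 0, U, by abel, fun i x => ?_,
    fun i x => rfl, fun i x => ?_, ?_, hzero, ?_, fun hne => ?_⟩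
  · have : CompleteSpace (p i).range := (hcl i).completeSpace_coe
    rw [isMeromorphicOperator_iff]
    intro z hz
    rw [← corner_sub_algebraMap (hp.idem i), hshift]
    obtain ⟨m, b, hb, hm⟩ := hD i (c i + z) (by simpa using hz)
    exact isDrazinInvertible_corner (hp.idem i) (hsub i _) (hb _ (hpT i).symm).symm
      ((hb T (.refl T)).symm.sub_left (Algebra.commutes _ _)) hm
  · rw [mul_zero, zero_mul, sub_zero]
    exact hzero
  · show T x = (corner (p i) (T - algebraMap ℂ (X →L[ℂ] X) (c i)) x : X) + 0 + c i • (x : X)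
    rw [hcorner, add_zero, sub_add_cancel]
  · rw [sub_apply, hUV, hcorner]
  · rw [hUV]
    rfl
  · rw [isMeromorphicOperator_iff]
    intro z hz
    -- On the range of p i the operator T - U - z agrees with T - (c i + z), and c i + z ≠ c i.
    refine isDrazinInvertible_of_forall_mul_eq hp (T := T) hcomm (fun y hTy hpy => ?_)
      (y := fun i => T - algebraMap ℂ (X →L[ℂ] X) (c i + z))
      (fun i => (Commute.refl T).sub_right (Algebra.commutes _ T).symm) (fun i => ?_)
      fun i => hD i _ (by simpa using hz)
    · refine (hTy.sub_left ?_).sub_left (Algebra.commutes z y)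
      exact (commute_sum_smul (fun i => (hpy i).symm) c).symm
    · rw [← hshift, sub_mul, sub_mul, sub_mul, sub_mul, hU, sum_smul_mul_of_orthogonal hp.1,
        ← Algebra.smul_def (c i)]
  · rw [mul_zero, zero_mul, sub_zero]
    exact hzero
  · rw [bFredholmSpectrum_eq_drazinSpectrum hfin] at hne ⊢
    rw [hU, spectrum_sum_smul hp]
    ext z
    constructor
    · rintro ⟨i, rfl, -⟩
      exact hcσ hne i
    · exact hσc z
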